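/- **Theorem 3.1 (Multilevel Robbins–Monro approximation).** Let $p\in[2,\infty)$, let $\langle\cdot,\cdot\rangle$ be a scalar product on $\mathbb R^d$ with induced norm $\|\cdot\|$, let $U$ be a random variable on a probability space $(\Omega,\mathcal F,\mathbb P)$ with values in a measurable space $\mathcal U$, and let $F,F_1,F_2,\ldots:\mathbb R^d\times\mathcal U\to\mathbb R^d$ be product-measurable such that $F(\theta,U)$ and $F_k(\theta,U)$ are integrable for all $\theta\in\mathbb R^d$, $k\in\mathbb N=\{1,2,\ldots\}$. Put $F_0=0$ and $f(\theta)=\mathbb E[F(\theta,U)]$, assume that $f$ has a unique zero $\theta^*$, and let $C_k\in(0,\infty)$, $k\in\mathbb N$ (the cost of simulating $F_k(\theta,U)-F_{k-1}(\theta,U)$). Assume the following. * **A.1** There are $L,L'\in(0,\infty)$ such that for all $\theta\in\mathbb R^d$: $\langle\theta-\theta^*,f(\theta)\rangle\le -L\|\theta-\theta^*\|^2$ and $\langle\theta-\theta^*,f(\theta)\rangle\le -L'\|f(\theta)\|^2$. * **C.1** There are measurable $\Gamma_1,\Gamma_2:\mathbb R^d\to(0,\infty)$ and constants $M\in(1,\infty)$,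 $K,\alpha,\beta\in(0,\infty)$ with $\alpha\ge\beta$ such that for all $k\in\mathbb N$, $\theta\in\mathbb R^d$: (i) $\mathbb E\big[\|F_k(\theta,U)-F_{k-1}(\theta,U)-\mathbb E[F_k(\theta,U)-F_{k-1}(\theta,U)]\|^p\big]^{1/p}\le\Gamma_1(\theta)M^{-k\beta}$, (ii) $\|\mathbb E[F_k(\theta,U)-F(\theta,U)]\|\le\Gamma_2(\theta)M^{-k\alpha}$, (iii) $C_k\le KM^k$. * **C.2** There are $K_1\in(0,\infty)$ and $\beta_1\ge 0$, with $\beta_1\le\min(\beta,1/2)$ if $\beta\ne1/2$ and $\beta_1<1/2$ if $\beta=1/2$, such that $\Gamma_1(\theta)\le K_1(1+\|\theta\|)^{\beta_1p}$ and $\Gamma_2(\theta)\le K_1(1+\|\theta\|)^{\alpha p}$ for all $\theta\in\mathbb R^d$. Let $\theta_0\in\mathbb R^d$, $r\in(-1,\infty)$, $\gamma_0\in(\frac{1+r}{2L},\infty)$, $\sigma_0,\varepsilon_0\in(0,\infty)$, $\rho=\frac12(1+r)$, and for $n\in\mathbb N$ $$\gamma_n=\gamma_0\frac1n,\qquad \sigma_n>0,\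 \ \sigma_n^2=\sigma_0^2\frac1{n^r},\qquad \varepsilon_n=\varepsilon_0\frac1{n^\rho}.$$ Let $(U_{n,k,\ell})_{n,k,\ell\in\mathbb N}$ be independent copies of $U$ and, for $n,k\in\mathbb N$ and $\theta\in\mathbb R^d$, put $$m_n(\theta)=1\vee\Big\lceil\tfrac1\alpha\log_M\tfrac{\Gamma_2(\theta)}{\varepsilon_n}\Big\rceil,\qquad N_{n,k}(\theta)=\big\lceil\kappa_n(\theta)M^{-k(\beta+1/2)}\big\rceil,$$ where $\kappa_n(\theta)=(\Gamma_1(\theta)/\sigma_n)^2M^{m_n(\theta)(1/2-\beta)_+}$ if $\beta\neq1/2$ and $\kappa_n(\theta)=(\Gamma_1(\theta)/\sigma_n)^2m_n(\theta)$ if $\beta=1/2$. Define the multilevel Robbins–Monro scheme by $\theta_n=\theta_{n-1}+\gamma_nZ_n(\theta_{n-1})$, $n\in\mathbb N$, with $$Z_n(\theta)=\sum_{k=1}^{m_n(\theta)}\frac1{N_{n,k}(\theta)}\sum_{\ell=1}^{N_{n,k}(\theta)}\big(F_k(\theta,U_{n,k,\ell})-F_{k-1}(\theta,U_{n,k,\ell})\big),$$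 and let $$\mathrm{cost}_n=\mathbb E\Big[\sum_{j=1}^n\sum_{k=1}^{m_j(\theta_{j-1})}N_{j,k}(\theta_{j-1})\,C_k\Big].$$ Then for every $\eta\in(0,\rho)$ there is $\kappa\in(0,\infty)$ such that for all $n\in\mathbb N$ $$\mathbb E\Big[\sup_{k\ge n}k^{\eta p}\|\theta_k-\theta^*\|^p\Big]^{1/p}\le\kappa\,n^{-(\rho-\eta)}.$$ In particular, for every $\delta\in(0,\infty)$, $\lim_{n\to\infty}n^{\rho-\delta}\|\theta_n-\theta^*\|=0$ almost surely. If additionally $\alpha>\beta\wedge\frac12$ and $r>\dfrac{\beta\wedge\frac12}{\alpha-\beta\wedge\frac12}$, then there is $\kappa'\in(0,\infty)$ such that for all $n\in\mathbb N$ $$\mathrm{cost}_n\le\kappa'\begin{cases}n^{2\rho},&\beta>1/2,\\ n^{2\rho}(\ln(n+1))^2,&\beta=1/2,\\ n^{2\rho\left(1+\frac{1-2\beta}{2\alpha}\right)},&\beta<1/2.\end{cases}$$ -/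

import Mathlib

open MeasureTheory ProbabilityTheory Filter Topology
open scoped ENNReal

noncomputable section

namespace MLRM

variable {E : Type*} [NormedAddCommGroup E] [InnerProductSpace ℝ E]
variable {Ω : Type*} [MeasurableSpace Ω] {S : Type*}

/-- The function `f(θ) = E[F(θ, U)]`. -/
def meanFun (P : Measure Ω) (U : Ω → S) (F : E × S → E) (θ : E) : E :=
  ∫ ω, F (θ, U ω) ∂P

/-- The contraction and growth conditions on `f` relative to its zero `θstar`, with the constant
`L` of the contraction condition displayed. -/
structure AssumptionA1 (f : E → E) (θstar : E) (L : ℝ) : Prop where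
  L_pos : 0 < L
  contraction : ∀ θ, inner ℝ (θ - θstar) (f θ) ≤ -L * ‖θ - θstar‖ ^ 2
  growth : ∃ L' : ℝ, 0 < L' ∧ ∀ θ, inner ℝ (θ - θstar) (f θ) ≤ -L' * ‖f θ‖ ^ 2

/-- The parameters that determine the multilevel scheme, apart from its starting value: the
functions and constants of the bounds on variance, bias and cost, the step-sizes `γ n`, the
bias-levels `ε n` and the noise-levels `σ n`. The sequences are used for `n ≥ 1` only. -/
structure Params (E : Type*) where
  Γ₁ : E → ℝ
  Γ₂ : E → ℝ
  M : ℝ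
  α : ℝ
  β : ℝ
  γ : ℕ → ℝ
  ε : ℕ → ℝ
  σ : ℕ → ℝ

/-- The assumptions on the approximations `Fk 1, Fk 2, …` of `F` and on the costs `C 1, C 2, …`.
The `p`-th central moment is measured by `eLpNorm`, so that the bound includes its finiteness. -/
structure AssumptionC1 [MeasurableSpace E] (P : Measure Ω) (U : Ω → S) (p : ℝ)
    (F : E × S → E) (Fk : ℕ → E × S → E) (C : ℕ → ℝ) (A : Params E) : Prop where
  measurable_Γ₁ : Measurable A.Γ₁
  measurable_Γ₂ : Measurable A.Γ₂
  Γ₁_pos : ∀ θ, 0 < A.Γ₁ θ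
  Γ₂_pos : ∀ θ, 0 < A.Γ₂ θ
  one_lt_M : 1 < A.M
  α_pos : 0 < A.α
  β_pos : 0 < A.β
  β_le_α : A.β ≤ A.α
  moment : ∀ k : ℕ, 1 ≤ k → ∀ θ : E,
    eLpNorm (fun ω => (Fk k (θ, U ω) - Fk (k - 1) (θ, U ω))
        - ∫ ω', (Fk k (θ, U ω') - Fk (k - 1) (θ, U ω')) ∂P) (ENNReal.ofReal p) P
      ≤ ENNReal.ofReal (A.Γ₁ θ * A.M ^ (-((k : ℝ) * A.β)))
  bias : ∀ k : ℕ, 1 ≤ k → ∀ θ : E,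
    ‖∫ ω, (Fk k (θ, U ω) - F (θ, U ω)) ∂P‖ ≤ A.Γ₂ θ * A.M ^ (-((k : ℝ) * A.α))
  cost : ∃ K : ℝ, 0 < K ∧ ∀ k : ℕ, 1 ≤ k → C k ≤ K * A.M ^ k

/-- The growth condition on `Γ₁` and `Γ₂`. -/
def AssumptionC2 (p : ℝ) (A : Params E) : Prop :=
  ∃ K₁ β₁ : ℝ, 0 < K₁ ∧ 0 ≤ β₁ ∧
    (A.β ≠ 1 / 2 → β₁ ≤ min A.β (1 / 2)) ∧ (A.β = 1 / 2 → β₁ < 1 / 2) ∧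
    ∀ θ : E, A.Γ₁ θ ≤ K₁ * (1 + ‖θ‖) ^ (β₁ * p) ∧ A.Γ₂ θ ≤ K₁ * (1 + ‖θ‖) ^ (A.α * p)

/-- The maximal level `m_n(θ) = 1 ∨ ⌈α⁻¹ log_M (Γ₂(θ) / ε_n)⌉`. -/
def maxLevel (A : Params E) (n : ℕ) (θ : E) : ℕ :=
  max 1 ⌈1 / A.α * Real.logb A.M (A.Γ₂ θ / A.ε n)⌉₊

/-- The factor `κ_n(θ)` in the number of iterations. -/
def iterFactor (A : Params E) (n : ℕ) (θ : E) : ℝ :=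
  if A.β = 1 / 2 then (A.Γ₁ θ / A.σ n) ^ 2 * (maxLevel A n θ : ℝ)
  else (A.Γ₁ θ / A.σ n) ^ 2 * A.M ^ ((maxLevel A n θ : ℝ) * max (1 / 2 - A.β) 0)

/-- The number of iterations `N_{n,k}(θ) = ⌈κ_n(θ) M^{-k(β+1/2)}⌉` on level `k`. -/
def numIter (A : Params E) (n k : ℕ) (θ : E) : ℕ :=
  ⌈iterFactor A n θ * A.M ^ (-((k : ℝ) * (A.β + 1 / 2)))⌉₊

/-- The multilevel estimator `Z_n(θ)`; `V n k l` with `n, k, l ≥ 1` are the copies of `U`. -/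
def estimator (A : Params E) (Fk : ℕ → E × S → E) (V : ℕ → ℕ → ℕ → Ω → S)
    (n : ℕ) (θ : E) (ω : Ω) : E :=
  ∑ k ∈ Finset.Icc 1 (maxLevel A n θ), (1 / (numIter A n k θ : ℝ)) •
    ∑ l ∈ Finset.Icc 1 (numIter A n k θ), (Fk k (θ, V n k l ω) - Fk (k - 1) (θ, V n k l ω))

/-- The multilevel Robbins-Monro scheme `θ_n = θ_{n-1} + γ_n Z_n(θ_{n-1})` started in `θ₀`. -/
def scheme (A : Params E) (Fk : ℕ → E × S → E) (V : ℕ → ℕ → ℕ → Ω → S) (θ₀ : E) :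
    ℕ → Ω → E
  | 0, _ => θ₀
  | n + 1, ω => scheme A Fk V θ₀ n ω
      + A.γ (n + 1) • estimator A Fk V (n + 1) (scheme A Fk V θ₀ n ω) ω

/-- The cost `cost_n = E[∑_{j=1}^n ∑_{k=1}^{m_j(θ_{j-1})} N_{j,k}(θ_{j-1}) C_k]`, the expectation
of a non-negative random variable, as an extended non-negative number. -/
def cost (P : Measure Ω) (A : Params E) (Fk : ℕ → E × S → E) (V : ℕ → ℕ → ℕ → Ω → S)
    (θ₀ : E) (C : ℕ → ℝ) (n : ℕ) : ℝ≥0∞ :=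
  ∫⁻ ω, ENNReal.ofReal (∑ j ∈ Finset.Icc 1 n,
    ∑ k ∈ Finset.Icc 1 (maxLevel A j (scheme A Fk V θ₀ (j - 1) ω)),
      (numIter A j k (scheme A Fk V θ₀ (j - 1) ω) : ℝ) * C k) ∂P

/-- The order of the cost bound in the three regimes of `β`. -/
def costRate (α β ρ : ℝ) (n : ℕ) : ℝ :=
  if 1 / 2 < β then (n : ℝ) ^ (2 * ρ)
  else if β = 1 / 2 then (n : ℝ) ^ (2 * ρ) * Real.log ((n : ℝ) + 1) ^ 2
  else (n : ℝ) ^ (2 * ρ * (1 + (1 - 2 * β) / (2 * α)))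

end MLRM

end

/-!
The error `e n = θ n - θ*` of the scheme satisfies `e (n + 1) = e n + d n + ζ n`. Here `d n` is the
step-size times the conditional mean of the multilevel estimator, and `ζ n` is a martingale
difference.

* Monotonicity and growth of `f` make `θ ↦ θ + (γ₀ / n) f θ` contract towards `θ*` by a factor
  `1 - lam / n` with `ρ < lam < γ₀ L` once `n` is large (`AssumptionA1.exists_contraction`). The
  choice of the maximal level bounds the bias by `ε n`, so that it adds `O(n ^ (-1 - ρ))` to the drift.
* The choice of the numbers of iterations bounds the `L^p` norm of the estimator's noise by a
  constant times `σ n`, uniformly in `θ` (`exists_lpNorm_levelSum_le`). As step `n` uses samples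
  independent of the past, Fubini's theorem carries this bound and the centring over to the random
  parameter; no conditional expectations are needed (`isMartingaleDiff_levelSum`).

Both facts together are `exists_isContractiveRecursion_scheme`. The analysis of the recursion rests
on one inequality, the `2`-smoothness of `L^p` for `p ≥ 2` (`exists_lpNorm_add_sq_le`): if `ξ` is
orthogonal to `‖X‖ ^ (p - 2) X`, then `‖X + ξ‖_p² ≤ ‖X‖_p² + C ‖ξ‖_p²`. The constant `1` in front of
`‖X‖_p²` preserves the contraction, so that the real sequence `‖e n‖_p` obeys a recursion which
yields `‖e n‖_p = O(n ^ (-ρ))`. The same inequality gives the Marcinkiewicz-Zygmund inequality used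
for the estimator and a Burkholder inequality for the noise. With Doob's inequality
(`IsMartingaleDiff.lpNorm_maxSum_le`) the maximum of `‖e k‖` over a block `n ≤ k ≤ 2 n` has `L^p`
norm `O(n ^ (-ρ))`, and summing a geometric series over the blocks `2 ^ i n ≤ k ≤ 2 ^ (i + 1) n` gives
the weighted maximal inequality, hence also the almost sure rate.

For the cost, one evaluation of the estimator at `θ` costs at most a constant times
`n ^ r (1 + ‖θ‖) ^ p`, up to the additional factor `costFactor` (`exists_sum_numIter_mul_le`). The
growth condition on `Γ₁` and `Γ₂` limits the power of `1 + ‖θ‖` to `p`, whose expectation along the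
scheme is bounded; the condition on `r` makes the rounding of the numbers of iterations harmless.
-/

/-! ### Uniform smoothness of `L^p` -/

namespace MLRM

/-- Second-order Bernoulli inequality on a bounded interval. -/
lemma exists_one_add_rpow_le {q : ℝ} (hq : 1 ≤ q) :
    ∃ C : ℝ, 0 ≤ C ∧ ∀ u : ℝ, -1 ≤ u → u ≤ 2 → (1 + u) ^ q ≤ 1 + q * u + C * u ^ 2 := by
  refine ⟨q * (q + (q - 1) * Real.exp (2 * (q - 1))), ?_, fun u h1 h2 => ?_⟩
  · have : 0 ≤ q - 1 := by linarith
    positivity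
  have hs : 0 ≤ q - 1 := by linarith
  rcases eq_or_lt_of_le h1 with rfl | h1
  · have : (0 : ℝ) ≤ (q - 1) * Real.exp (2 * (q - 1)) := by positivity
    norm_num
    rw [Real.zero_rpow (by linarith)]
    nlinarith
  have hpos : 0 < 1 + u := by linarith
  -- the tangent of the convex function `x ↦ x ^ q` at `1 + u`, evaluated at `1`
  have tangent : (1 + u) ^ q ≤ 1 + q * (u * (1 + u) ^ (q - 1)) := by
    have hv : -1 ≤ (1 + u)⁻¹ - 1 := by
      have := inv_pos.2 hpos
      linarith
    have hB := one_add_mul_self_le_rpow_one_add hv hq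
    rw [add_sub_cancel, Real.inv_rpow hpos.le] at hB
    have hq0 : 0 < (1 + u) ^ q := Real.rpow_pos_of_pos hpos q
    have hB' := mul_le_mul_of_nonneg_left hB hq0.le
    rw [mul_inv_cancel₀ hq0.ne'] at hB'
    have hsplit : (1 + u) ^ q = (1 + u) ^ (q - 1) * (1 + u) := by
      rw [← Real.rpow_add_one hpos.ne']; ring_nf
    have : (1 + u) ^ q * ((1 + u)⁻¹ - 1) = -(u * (1 + u) ^ (q - 1)) := by
      rw [hsplit]; field_simp; ring
    nlinarith
  have key : u * ((1 + u) ^ (q - 1) - 1) ≤ (q + (q - 1) * Real.exp (2 * (q - 1))) * u ^ 2 := by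
    rcases le_total 0 u with hu | hu
    · have e1 : (1 + u) ^ (q - 1) ≤ Real.exp (u * (q - 1)) := by
        rw [Real.exp_mul]
        exact Real.rpow_le_rpow hpos.le (by linarith [Real.add_one_le_exp u]) hs
      have e2 : Real.exp (u * (q - 1)) - 1 ≤ u * (q - 1) * Real.exp (u * (q - 1)) := by
        have h := Real.add_one_le_exp (-(u * (q - 1)))
        have h' := mul_le_mul_of_nonneg_right h (Real.exp_pos (u * (q - 1))).le
        rw [← Real.exp_add] at h'
        simp at h'
        linarith
      have e3 : Real.exp (u * (q - 1)) ≤ Real.exp (2 * (q - 1)) :=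
        Real.exp_le_exp.2 (mul_le_mul_of_nonneg_right h2 hs)
      have e4 : u * (q - 1) * Real.exp (u * (q - 1)) ≤ u * (q - 1) * Real.exp (2 * (q - 1)) :=
        mul_le_mul_of_nonneg_left e3 (by positivity)
      have e5 : (1 + u) ^ (q - 1) - 1 ≤ u * (q - 1) * Real.exp (2 * (q - 1)) := by linarith
      have e6 := mul_le_mul_of_nonneg_left e5 hu
      have : 0 ≤ q * u ^ 2 := by positivity
      nlinarith
    · have e1 : (1 + u) ^ q ≤ (1 + u) ^ (q - 1) :=
        Real.rpow_le_rpow_of_exponent_ge hpos (by linarith) (by linarith)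
      have e2 := one_add_mul_self_le_rpow_one_add h1.le hq
      have e3 : q * u ≤ (1 + u) ^ (q - 1) - 1 := by linarith
      have e4 := mul_le_mul_of_nonpos_left e3 hu
      have : 0 ≤ (q - 1) * Real.exp (2 * (q - 1)) * u ^ 2 := by positivity
      nlinarith
  have := mul_le_mul_of_nonneg_left key (by linarith : 0 ≤ q)
  nlinarith

variable {E : Type*} [NormedAddCommGroup E] [InnerProductSpace ℝ E]

/-- Second-order Taylor estimate for `‖·‖ ^ p` on an inner product space. -/
lemma exists_norm_add_rpow_le {p : ℝ} (hp : 2 ≤ p) :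
    ∃ C : ℝ, 1 ≤ C ∧ ∀ x y : E, ‖x + y‖ ^ p ≤ ‖x‖ ^ p + p * inner ℝ (‖x‖ ^ (p - 2) • x) y
      + C * (‖x‖ ^ (p - 2) * ‖y‖ ^ (2 : ℝ) + ‖y‖ ^ p) := by
  obtain ⟨C, hC, hB⟩ := exists_one_add_rpow_le (q := p / 2) (by linarith)
  have h3 : (0 : ℝ) ≤ 3 ^ p := by positivity
  refine ⟨p / 2 + 7 * C + 2 * p + 3 ^ p + 1, by linarith, fun x y => ?_⟩
  have hx0 : 0 ≤ ‖x‖ ^ (p - 2) := by positivity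
  have hy0 : 0 ≤ ‖y‖ ^ p := by positivity
  rw [real_inner_smul_left, Real.rpow_two]
  have hin := abs_le.1 (abs_real_inner_le_norm x y)
  have hT : 0 ≤ ‖x‖ ^ (p - 2) * ‖y‖ ^ 2 := by positivity
  -- for small `y` expand `‖x + y‖ ^ 2` relative to `‖x‖ ^ 2`; for large `y` the error terms dominate
  rcases le_total (2 * ‖y‖) ‖x‖ with h | h
  · rcases eq_or_ne x 0 with rfl | hx
    · have : y = 0 := by
        simp at h
        exact norm_le_zero_iff.1 (by linarith)
      subst this
      simp
      rw [Real.zero_rpow (by linarith)]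
      simp
    have hxp : 0 < ‖x‖ := norm_pos_iff.2 hx
    set A := ‖x‖ ^ 2 with hA
    have hAp : 0 < A := by positivity
    set B := 2 * inner ℝ x y + ‖y‖ ^ 2 with hBdef
    have hAB : ‖x + y‖ ^ 2 = A + B := by rw [norm_add_sq_real]; ring
    have hAq : A ^ (p / 2) = ‖x‖ ^ p := by
      rw [hA, ← Real.rpow_natCast, ← Real.rpow_mul hxp.le]; congr 1; push_cast; ring
    have hABq : (A + B) ^ (p / 2) = ‖x + y‖ ^ p := by
      rw [← hAB, ← Real.rpow_natCast, ← Real.rpow_mul (norm_nonneg _)]; congr 1; push_cast; ring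
    have hAm : ‖x‖ ^ p = ‖x‖ ^ (p - 2) * A := by
      rw [hA, ← Real.rpow_two, ← Real.rpow_add hxp]; ring_nf
    have hABn : 0 ≤ A + B := by rw [← hAB]; positivity
    have hBu : B ≤ 5 / 2 * (‖x‖ * ‖y‖) := by
      nlinarith [norm_nonneg y]
    have hBl : -(5 / 2 * (‖x‖ * ‖y‖)) ≤ B := by
      nlinarith [norm_nonneg y, norm_nonneg x, mul_nonneg (norm_nonneg x) (norm_nonneg y)]
    have hB2 : B ^ 2 ≤ 7 * A * ‖y‖ ^ 2 := by
      have := sq_le_sq' hBl hBu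
      have h' : 0 ≤ A * ‖y‖ ^ 2 := by positivity
      calc B ^ 2 ≤ _ := this
        _ = 25 / 4 * (A * ‖y‖ ^ 2) := by rw [hA]; ring
        _ ≤ _ := by linarith
    have hu1 : -1 ≤ B / A := by rw [le_div_iff₀ hAp]; linarith
    have hu2 : B / A ≤ 2 := by
      rw [div_le_iff₀ hAp]
      nlinarith
    have hmain := hB (B / A) hu1 hu2
    have e1 : ‖x + y‖ ^ p = ‖x‖ ^ p * (1 + B / A) ^ (p / 2) := by
      rw [← hABq, ← hAq, ← Real.mul_rpow hAp.le (by linarith)]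
      congr 1; field_simp
    rw [e1]
    have e2 := mul_le_mul_of_nonneg_left hmain (Real.rpow_nonneg hxp.le p)
    have e3 : ‖x‖ ^ p * (1 + p / 2 * (B / A) + C * (B / A) ^ 2)
        = ‖x‖ ^ p + p / 2 * (‖x‖ ^ (p - 2) * B) + C * (‖x‖ ^ (p - 2) * (B ^ 2 / A)) := by
      rw [hAm]; field_simp
    have e4 : B ^ 2 / A ≤ 7 * ‖y‖ ^ 2 := by
      rw [div_le_iff₀ hAp]; linarith
    have e5 : C * (‖x‖ ^ (p - 2) * (B ^ 2 / A)) ≤ C * (‖x‖ ^ (p - 2) * (7 * ‖y‖ ^ 2)) := by gcongr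
    have e6 : 0 ≤ (2 * p + 3 ^ p + 1) * (‖x‖ ^ (p - 2) * ‖y‖ ^ 2) := by positivity
    have e7 : 0 ≤ (p / 2 + 7 * C + 2 * p + 3 ^ p + 1) * ‖y‖ ^ p := by positivity
    rw [e3] at e2
    refine e2.trans ?_
    rw [hBdef] at *
    nlinarith
  · have e1 : ‖x + y‖ ^ p ≤ 3 ^ p * ‖y‖ ^ p := by
      rw [← Real.mul_rpow (by norm_num) (norm_nonneg _)]
      exact Real.rpow_le_rpow (norm_nonneg _) (by linarith [norm_add_le x y]) (by linarith)
    have e2 : -(2 * ‖y‖ ^ 2) ≤ inner ℝ x y := by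
      nlinarith [norm_nonneg y]
    have e3 : ‖x‖ ^ (p - 2) * -(2 * ‖y‖ ^ 2) ≤ ‖x‖ ^ (p - 2) * inner ℝ x y :=
      mul_le_mul_of_nonneg_left e2 hx0
    have e4 := mul_le_mul_of_nonneg_left e3 (by linarith : 0 ≤ p)
    have e5 : 0 ≤ ‖x‖ ^ p := by positivity
    have e6 : 0 ≤ (p / 2 + 7 * C + 3 ^ p + 1) * (‖x‖ ^ (p - 2) * ‖y‖ ^ 2) := by positivity
    have e7 : 0 ≤ (p / 2 + 7 * C + 2 * p + 1) * ‖y‖ ^ p := by positivity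
    nlinarith

variable {Ω : Type*} [MeasurableSpace Ω] {P : Measure Ω}

lemma integral_norm_rpow_eq_lpNorm {G : Type*} [NormedAddCommGroup G] {p : ℝ} (hp : 0 < p)
    {X : Ω → G}
    (hX : AEStronglyMeasurable X P) :
    ∫ ω, ‖X ω‖ ^ p ∂P = lpNorm X (ENNReal.ofReal p) P ^ p := by
  rw [lpNorm_eq_integral_norm_rpow_toReal (by simpa using hp) (by simp) hX,
    ENNReal.toReal_ofReal hp.le, ← Real.rpow_mul (integral_nonneg fun _ => by positivity),
    inv_mul_cancel₀ hp.ne', Real.rpow_one]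

lemma integrable_norm_rpow_ofReal {G : Type*} [NormedAddCommGroup G] {p : ℝ} (hp : 0 < p)
    {X : Ω → G}     (hX : MemLp X (ENNReal.ofReal p) P) : Integrable (fun ω => ‖X ω‖ ^ p) P := by
  have := hX.integrable_norm_rpow (by simpa using hp) (by simp)
  rwa [ENNReal.toReal_ofReal hp.le] at this

lemma lintegral_enorm_rpow_eq_lpNorm {G : Type*} [NormedAddCommGroup G] {p : ℝ} (hp : 0 < p)
    {Z : Ω → G} (hZ : MemLp Z (ENNReal.ofReal p) P) (s : ℝ) :
    (∫⁻ ω, ‖Z ω‖ₑ ^ p ∂P) ^ (s / p) = ENNReal.ofReal (lpNorm Z (ENNReal.ofReal p) P) ^ s := by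
  rw [ofReal_lpNorm hZ, eLpNorm_eq_lintegral_rpow_enorm_toReal (by simpa using hp) (by simp),
    ENNReal.toReal_ofReal hp.le, ← ENNReal.rpow_mul]
  congr 1; field_simp

/-- Hölder's inequality for `‖X‖ ^ s * ‖Y‖ ^ t` with `s + t = p`. -/
lemma integral_rpow_mul_rpow_le {G F : Type*} [NormedAddCommGroup G] [NormedAddCommGroup F]
    {p s t : ℝ} (hp : 0 < p) (hs : 0 ≤ s) (ht : 0 ≤ t) (hst : s + t = p) {X : Ω → G} {Y : Ω → F} (hX : MemLp X (ENNReal.ofReal p) P)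
    (hY : MemLp Y (ENNReal.ofReal p) P) :
    Integrable (fun ω => ‖X ω‖ ^ s * ‖Y ω‖ ^ t) P ∧
    ∫ ω, ‖X ω‖ ^ s * ‖Y ω‖ ^ t ∂P
      ≤ lpNorm X (ENNReal.ofReal p) P ^ s * lpNorm Y (ENNReal.ofReal p) P ^ t := by
  have hmX := hX.1.enorm
  have hmY := hY.1.enorm
  have hH := ENNReal.lintegral_mul_norm_pow_le (μ := P) (p := s / p) (q := t / p)
    (f := fun ω => ‖X ω‖ₑ ^ p) (g := fun ω => ‖Y ω‖ₑ ^ p)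
    (hmX.pow_const p) (hmY.pow_const p) (by positivity) (by positivity)
    (by rw [← add_div, hst, div_self hp.ne'])
  have e (a : ℝ≥0∞) (s : ℝ) : (a ^ p) ^ (s / p) = a ^ s := by
    rw [← ENNReal.rpow_mul, mul_div_cancel₀ _ hp.ne']
  simp only [e] at hH
  rw [lintegral_enorm_rpow_eq_lpNorm hp hX, lintegral_enorm_rpow_eq_lpNorm hp hY,
    ENNReal.ofReal_rpow_of_nonneg lpNorm_nonneg hs,
    ENNReal.ofReal_rpow_of_nonneg lpNorm_nonneg ht,
    ← ENNReal.ofReal_mul (Real.rpow_nonneg lpNorm_nonneg _)] at hH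
  have hpt (ω) : ‖X ω‖ₑ ^ s * ‖Y ω‖ₑ ^ t = ENNReal.ofReal (‖X ω‖ ^ s * ‖Y ω‖ ^ t) := by
    rw [ENNReal.ofReal_mul (by positivity), ← ENNReal.ofReal_rpow_of_nonneg (norm_nonneg _) hs,
      ← ENNReal.ofReal_rpow_of_nonneg (norm_nonneg _) ht, ofReal_norm, ofReal_norm]
  simp only [hpt] at hH
  have hmeas : AEStronglyMeasurable (fun ω => ‖X ω‖ ^ s * ‖Y ω‖ ^ t) P :=
    ((hX.1.norm.aemeasurable.pow_const s).mul (hY.1.norm.aemeasurable.pow_const t)).aestronglyMeasurable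
  have hnn : 0 ≤ᵐ[P] fun ω => ‖X ω‖ ^ s * ‖Y ω‖ ^ t := ae_of_all _ fun ω => by positivity
  refine ⟨⟨hmeas, ?_⟩, ?_⟩
  · rw [hasFiniteIntegral_iff_ofReal hnn]
    exact hH.trans_lt ENNReal.ofReal_lt_top
  · rw [integral_eq_lintegral_of_nonneg_ae hnn hmeas]
    exact ENNReal.toReal_le_of_le_ofReal
      (mul_nonneg (Real.rpow_nonneg lpNorm_nonneg _) (Real.rpow_nonneg lpNorm_nonneg _)) hH

/-- Integrability of the linear term in the expansion of `‖X + ξ‖ ^ p`. -/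
lemma integrable_inner_rpow_smul {p : ℝ} (hp : 2 ≤ p) {X ξ : Ω → E}
    (hX : MemLp X (ENNReal.ofReal p) P) (hξ : MemLp ξ (ENNReal.ofReal p) P) :
    Integrable (fun ω => inner ℝ (‖X ω‖ ^ (p - 2) • X ω) (ξ ω)) P := by
  have h1 := (integral_rpow_mul_rpow_le (s := p - 1) (t := 1) (by linarith) (by linarith) (by simp)
    (by ring) hX hξ).1
  refine h1.mono' ?_ (ae_of_all _ fun ω => ?_)
  · exact (((hX.1.norm.aemeasurable.pow_const (p - 2)).aestronglyMeasurable).smul hX.1).inner hξ.1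
  · refine (norm_inner_le_norm _ _).trans (le_of_eq ?_)
    rw [norm_smul, Real.norm_of_nonneg (by positivity), Real.rpow_one]
    rcases eq_or_ne (X ω) 0 with h | h
    · simp [h, Real.zero_rpow (by linarith : p - 1 ≠ 0)]
    · rw [← Real.rpow_add_one (norm_ne_zero_iff.2 h)]; ring_nf

/-- `L^p` over an inner product space is uniformly smooth of power type `2` for `p ≥ 2`, in the
form needed for martingale differences: the first summand enters with constant `1`. -/
theorem exists_lpNorm_add_sq_le {p : ℝ} (hp : 2 ≤ p) (P : Measure Ω) :
    ∃ C : ℝ, 1 ≤ C ∧ ∀ X ξ : Ω → E, MemLp X (ENNReal.ofReal p) P → MemLp ξ (ENNReal.ofReal p) P →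
      ∫ ω, inner ℝ (‖X ω‖ ^ (p - 2) • X ω) (ξ ω) ∂P = 0 →
      lpNorm (fun ω => X ω + ξ ω) (ENNReal.ofReal p) P ^ 2
        ≤ lpNorm X (ENNReal.ofReal p) P ^ 2 + C * lpNorm ξ (ENNReal.ofReal p) P ^ 2 := by
  obtain ⟨C, hC, hpt⟩ := exists_norm_add_rpow_le (E := E) hp
  refine ⟨2 * C, by linarith, fun X ξ hX hξ h0 => ?_⟩
  have hp0 : 0 < p := by linarith
  set a := lpNorm X (ENNReal.ofReal p) P with ha
  set b := lpNorm ξ (ENNReal.ofReal p) P with hb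
  have ha0 : 0 ≤ a := lpNorm_nonneg
  have hb0 : 0 ≤ b := lpNorm_nonneg
  set c := lpNorm (fun ω => X ω + ξ ω) (ENNReal.ofReal p) P with hc
  have hc0 : 0 ≤ c := lpNorm_nonneg
  have hXξ : MemLp (fun ω => X ω + ξ ω) (ENNReal.ofReal p) P := hX.add hξ
  obtain ⟨hi, hle⟩ := integral_rpow_mul_rpow_le (s := p - 2) (t := 2) hp0 (by linarith) (by simp)
    (by ring) hX hξ
  have hI1 := integrable_inner_rpow_smul hp hX hξ
  have hiX := integrable_norm_rpow_ofReal hp0 hX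
  have hiξ := integrable_norm_rpow_ofReal hp0 hξ
  have h1 : c ^ p ≤ a ^ p + C * (a ^ (p - 2) * b ^ (2 : ℝ) + b ^ p) := by
    rw [hc, ← integral_norm_rpow_eq_lpNorm hp0 hXξ.1]
    refine (integral_mono (integrable_norm_rpow_ofReal hp0 hXξ)
      ((hiX.add (hI1.const_mul p)).add ((hi.add hiξ).const_mul C)) fun ω => hpt (X ω) (ξ ω)).trans ?_
    rw [integral_add' (hiX.add (hI1.const_mul p)) ((hi.add hiξ).const_mul C),
      integral_add' hiX (hI1.const_mul p), integral_const_mul, integral_const_mul, h0,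
      integral_add' hi hiξ, integral_norm_rpow_eq_lpNorm hp0 hX.1,
      integral_norm_rpow_eq_lpNorm hp0 hξ.1]
    simp only [mul_zero, add_zero]
    gcongr
  -- `(a² + 2 C b²) ^ (p / 2)` dominates this bound, by Bernoulli's inequality and by
  -- superadditivity of `x ↦ x ^ (p / 2)`
  have h2 : c ^ p ≤ (a ^ 2 + 2 * C * b ^ 2) ^ (p / 2) := by
    refine h1.trans ?_
    have sqp (x : ℝ) (hx : 0 ≤ x) : (x ^ 2) ^ (p / 2) = x ^ p := by
      rw [← Real.rpow_natCast, ← Real.rpow_mul hx]; congr 1; push_cast; ring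
    have s1 : a ^ p + 2 * C * b ^ p ≤ (a ^ 2 + 2 * C * b ^ 2) ^ (p / 2) := by
      have := Real.add_rpow_le_rpow_add (p := p / 2) (sq_nonneg a)
        (by positivity : 0 ≤ 2 * C * b ^ 2) (by linarith)
      rw [sqp a ha0, Real.mul_rpow (by linarith) (sq_nonneg b), sqp b hb0] at this
      have h2C : 2 * C ≤ (2 * C) ^ (p / 2) :=
        Real.self_le_rpow_of_one_le (by linarith) (by linarith)
      have := mul_le_mul_of_nonneg_right h2C (Real.rpow_nonneg hb0 p)
      linarith
    have s2 : a ^ p + 2 * C * (a ^ (p - 2) * b ^ (2 : ℝ)) ≤ (a ^ 2 + 2 * C * b ^ 2) ^ (p / 2) := by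
      rcases eq_or_lt_of_le ha0 with h | h
      · rcases eq_or_lt_of_le hp with hp2 | hp2
        · rw [← hp2, ← h]; norm_num
        · rw [← h, Real.zero_rpow (by linarith), Real.zero_rpow (by linarith)]
          simp only [zero_mul, mul_zero, add_zero]
          positivity
      · have hu : -1 ≤ 2 * C * b ^ 2 / a ^ 2 :=
          le_trans (by norm_num) (by positivity : 0 ≤ 2 * C * b ^ 2 / a ^ 2)
        have hB := one_add_mul_self_le_rpow_one_add (p := p / 2) hu (by linarith)
        have e1 : (a ^ 2 + 2 * C * b ^ 2) ^ (p / 2) = a ^ p * (1 + 2 * C * b ^ 2 / a ^ 2) ^ (p / 2) := by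
          rw [← sqp a ha0, ← Real.mul_rpow (by positivity) (by positivity)]
          congr 1; field_simp
        have e2 : a ^ p = a ^ (p - 2) * a ^ 2 := by
          rw [← Real.rpow_two, ← Real.rpow_add h]; ring_nf
        rw [e1]
        refine le_trans ?_ (mul_le_mul_of_nonneg_left hB (Real.rpow_nonneg ha0 p))
        have e3 : a ^ p * (1 + p / 2 * (2 * C * b ^ 2 / a ^ 2))
            = a ^ p + p / 2 * (2 * C * (a ^ (p - 2) * b ^ 2)) := by
          rw [e2]; field_simp
        rw [e3, Real.rpow_two]
        have : 0 ≤ 2 * C * (a ^ (p - 2) * b ^ 2) := by positivity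
        nlinarith
    linarith
  have hR : 0 ≤ a ^ 2 + 2 * C * b ^ 2 := by positivity
  have h3 : (c ^ 2) ^ (p / 2) ≤ (a ^ 2 + 2 * C * b ^ 2) ^ (p / 2) := by
    refine le_trans (le_of_eq ?_) h2
    rw [← Real.rpow_natCast, ← Real.rpow_mul hc0]; congr 1; push_cast; ring
  exact (Real.rpow_le_rpow_iff (by positivity) hR (by linarith)).1 h3

end MLRM

/-! ### Independent sums, martingale differences and Doob's inequality -/

namespace MLRM

section MaxSum

variable {E Ω : Type*} [NormedAddCommGroup E]

/-- The running maximum of the norms of the partial sums. -/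
def maxSum (ζ : ℕ → Ω → E) (n : ℕ) (ω : Ω) : ℝ :=
  partialSups (fun k => ‖∑ i ∈ Finset.range k, ζ i ω‖) n

lemma norm_sum_le_maxSum (ζ : ℕ → Ω → E) {k n : ℕ} (hk : k ≤ n) (ω : Ω) :
    ‖∑ i ∈ Finset.range k, ζ i ω‖ ≤ maxSum ζ n ω :=
  le_partialSups_of_le (fun k => ‖∑ i ∈ Finset.range k, ζ i ω‖) hk

lemma maxSum_nonneg (ζ : ℕ → Ω → E) (n : ℕ) (ω : Ω) : 0 ≤ maxSum ζ n ω :=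
  (norm_nonneg _).trans (norm_sum_le_maxSum ζ le_rfl ω)

lemma maxSum_zero (ζ : ℕ → Ω → E) (ω : Ω) : maxSum ζ 0 ω = 0 := by
  simp [maxSum]

lemma maxSum_succ (ζ : ℕ → Ω → E) (n : ℕ) (ω : Ω) :
    maxSum ζ (n + 1) ω = max (maxSum ζ n ω) ‖∑ i ∈ Finset.range (n + 1), ζ i ω‖ :=
  partialSups_add_one _ _

end MaxSum

/-- Convexity estimate behind Doob's inequality. -/
lemma rpow_mul_sub_half_rpow_le {p : ℝ} (hp : 2 ≤ p) {a b : ℝ} (ha : 0 ≤ a) (hb : 0 ≤ b) :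
    a ^ (p - 1) * b - 1 / 2 * a ^ p ≤ max a b ^ (p - 1) * b - 1 / 2 * max a b ^ p := by
  rcases le_total b a with h | h
  · rw [max_eq_left h]
  rw [max_eq_right h]
  have e (x : ℝ) (hx : 0 ≤ x) : x ^ p = x ^ (p - 1) * x := by
    rcases eq_or_lt_of_le hx with rfl | hx
    · rw [Real.zero_rpow (by linarith)]; simp
    · rw [← Real.rpow_add_one hx.ne']; ring_nf
  have hmono : a ^ (p - 2) ≤ b ^ (p - 2) := Real.rpow_le_rpow ha h (by linarith)
  rcases eq_or_lt_of_le ha with rfl | ha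
  · rw [Real.zero_rpow (by linarith), Real.zero_rpow (by linarith), ← e b hb]
    have := Real.rpow_nonneg hb p
    linarith
  have e1 : a ^ p = a ^ (p - 2) * a ^ 2 := by
    rw [← Real.rpow_two, ← Real.rpow_add ha]; ring_nf
  have e2 : b ^ p = b ^ (p - 2) * b ^ 2 := by
    rw [← Real.rpow_two, ← Real.rpow_add (ha.trans_le h)]; ring_nf
  have e3 : a ^ (p - 1) = a ^ (p - 2) * a := by
    rw [← Real.rpow_add_one ha.ne']; ring_nf
  rw [← e b hb, e1, e2, e3]
  have := mul_le_mul_of_nonneg_right hmono (sq_nonneg b)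
  have h2 := mul_nonneg (Real.rpow_nonneg ha.le (p - 2)) (sq_nonneg (a - b))
  nlinarith

section Definition

variable {E : Type*} [NormedAddCommGroup E] [InnerProductSpace ℝ E] [MeasurableSpace E]
variable {Ω : Type*} [mΩ : MeasurableSpace Ω] {P : Measure Ω}

/-- `ζ` is a sequence of `L^p` martingale differences for the filtration `𝓕`, the increment `ζ i`
being revealed at time `i + 1`. The martingale property is expressed by orthogonality of `ζ i` to
everything `𝓕 i`-measurable. -/
structure IsMartingaleDiff (P : Measure Ω) (𝓕 : Filtration ℕ mΩ) (p : ℝ) (ζ : ℕ → Ω → E) :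
    Prop where
  measurable : ∀ i, Measurable[𝓕 (i + 1)] (ζ i)
  memLp : ∀ i, MemLp (ζ i) (ENNReal.ofReal p) P
  orthogonal : ∀ i (Y : Ω → E), Measurable[𝓕 i] Y →
    Integrable (fun ω => inner ℝ (Y ω) (ζ i ω)) P → ∫ ω, inner ℝ (Y ω) (ζ i ω) ∂P = 0

namespace IsMartingaleDiff

variable {𝓕 : Filtration ℕ mΩ} {p : ℝ} {ζ : ℕ → Ω → E}

lemma shift (h : IsMartingaleDiff P 𝓕 p ζ) (n : ℕ) :
    IsMartingaleDiff P ⟨fun i => 𝓕 (n + i), fun _ _ hij => 𝓕.mono (by omega), fun _ => 𝓕.le _⟩ p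
      (fun i => ζ (n + i)) :=
  ⟨fun i => h.measurable (n + i), fun i => h.memLp (n + i), fun i => h.orthogonal (n + i)⟩

lemma memLp_sum (h : IsMartingaleDiff P 𝓕 p ζ) (n : ℕ) :
    MemLp (fun ω => ∑ i ∈ Finset.range n, ζ i ω) (ENNReal.ofReal p) P :=
  memLp_finsetSum _ fun i _ => h.memLp i

lemma memLp_maxSum (h : IsMartingaleDiff P 𝓕 p ζ) (n : ℕ) :
    MemLp (maxSum ζ n) (ENNReal.ofReal p) P := by
  induction n with
  | zero =>
    have : maxSum ζ 0 = fun _ => 0 := funext fun ω => maxSum_zero ζ ω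
    rw [this]; exact MemLp.zero'
  | succ n ih =>
    have : maxSum ζ (n + 1) = maxSum ζ n ⊔ fun ω => ‖∑ i ∈ Finset.range (n + 1), ζ i ω‖ :=
      funext fun ω => maxSum_succ ζ n ω
    rw [this]
    exact ih.sup (h.memLp_sum (n + 1)).norm

lemma integrable_rpow_mul_maxSum (h : IsMartingaleDiff P 𝓕 p ζ) (hp : 2 ≤ p) (n : ℕ)
    {X : Ω → E} (hX : MemLp X (ENNReal.ofReal p) P) :
    Integrable (fun ω => maxSum ζ n ω ^ (p - 1) * ‖X ω‖) P := by
  refine (integral_rpow_mul_rpow_le (s := p - 1) (t := 1) (by linarith) (by linarith) (by simp)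
    (by ring) (h.memLp_maxSum n) hX).1.congr (ae_of_all _ fun ω => ?_)
  simp only [Real.rpow_one, Real.norm_of_nonneg (maxSum_nonneg ζ n ω)]

lemma integrable_rpow_maxSum (h : IsMartingaleDiff P 𝓕 p ζ) (hp : 2 ≤ p) (n : ℕ) :
    Integrable (fun ω => maxSum ζ n ω ^ p) P := by
  refine (integrable_norm_rpow_ofReal (by linarith) (h.memLp_maxSum n)).congr
    (ae_of_all _ fun ω => ?_)
  simp only [Real.norm_of_nonneg (maxSum_nonneg ζ n ω)]

end IsMartingaleDiff

end Definition

variable {E : Type*} [NormedAddCommGroup E] [InnerProductSpace ℝ E] [FiniteDimensional ℝ E]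
  [MeasurableSpace E] [BorelSpace E]
variable {Ω : Type*} [mΩ : MeasurableSpace Ω] {P : Measure Ω}

/-- A random variable `Y = φ(H)` is orthogonal to `G(H, B)` if `B` is independent of `H` and
`G(h, B)` is centred for every `h`. -/
lemma integral_inner_eq_zero_of_indepFun [IsProbabilityMeasure P] {T S : Type*}
    {mT : MeasurableSpace T} {mS : MeasurableSpace S} {H : Ω → T} {B : Ω → S} (hH : Measurable H)
    (hB : Measurable B) (hind : IndepFun H B P) {φ : T → E} (hφ : Measurable φ) {G : T × S → E}
    (hG : Measurable G) (hGint : ∀ h, Integrable (fun ω => G (h, B ω)) P)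
    (hG0 : ∀ h, ∫ ω, G (h, B ω) ∂P = 0)
    (hint : Integrable (fun ω => inner ℝ (φ (H ω)) (G (H ω, B ω))) P) :
    ∫ ω, inner ℝ (φ (H ω)) (G (H ω, B ω)) ∂P = 0 := by
  have hprod := (indepFun_iff_map_prod_eq_prod_map_map hH.aemeasurable hB.aemeasurable).1 hind
  have : IsProbabilityMeasure (P.map H) := Measure.isProbabilityMeasure_map hH.aemeasurable
  have : IsProbabilityMeasure (P.map B) := Measure.isProbabilityMeasure_map hB.aemeasurable
  have hm : Measurable fun x : T × S => (inner ℝ (φ x.1) (G x) : ℝ) :=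
    (hφ.comp measurable_fst).inner hG
  have hpair : Measurable fun ω => (H ω, B ω) := hH.prodMk hB
  have e : ∫ ω, inner ℝ (φ (H ω)) (G (H ω, B ω)) ∂P
      = ∫ x, (inner ℝ (φ x.1) (G x) : ℝ) ∂((P.map H).prod (P.map B)) := by
    rw [← hprod, integral_map hpair.aemeasurable hm.aestronglyMeasurable]
  have hint' : Integrable (fun x : T × S => (inner ℝ (φ x.1) (G x) : ℝ))
      ((P.map H).prod (P.map B)) := by
    rw [← hprod, integrable_map_measure hm.aestronglyMeasurable hpair.aemeasurable]
    exact hint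
  rw [e, integral_prod _ hint']
  refine integral_eq_zero_of_ae (ae_of_all _ fun h => ?_)
  have hGh : Measurable fun v => G (h, v) := hG.comp measurable_prodMk_left
  have hi : Integrable (fun v => G (h, v)) (P.map B) :=
    (integrable_map_measure hGh.aestronglyMeasurable hB.aemeasurable).2 (hGint h)
  simp only [Pi.zero_apply]
  rw [integral_inner hi, integral_map hB.aemeasurable hGh.aestronglyMeasurable, hG0, inner_zero_right]

/-- Marcinkiewicz-Zygmund inequality for `p ≥ 2`, with values in a Euclidean space. -/
lemma exists_lpNorm_sum_sq_le_of_iIndepFun {p : ℝ} (hp : 2 ≤ p) (P : Measure Ω)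
    [IsProbabilityMeasure P] :
    ∃ C : ℝ, 1 ≤ C ∧ ∀ {ι : Type} (X : ι → Ω → E), iIndepFun X P → (∀ i, Measurable (X i)) →
      (∀ i, MemLp (X i) (ENNReal.ofReal p) P) → (∀ i, ∫ ω, X i ω ∂P = 0) → ∀ s : Finset ι,
      lpNorm (fun ω => ∑ i ∈ s, X i ω) (ENNReal.ofReal p) P ^ 2
        ≤ C * ∑ i ∈ s, lpNorm (X i) (ENNReal.ofReal p) P ^ 2 := by
  obtain ⟨C, hC, hsm⟩ := exists_lpNorm_add_sq_le (E := E) hp P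
  refine ⟨C, hC, fun X hX hm hL h0 s => ?_⟩
  have hp1 : 1 ≤ ENNReal.ofReal p := by
    rw [← ENNReal.ofReal_one]; exact ENNReal.ofReal_le_ofReal (by linarith)
  classical
  induction s using Finset.induction_on with
  | empty => simp
  | insert i s hi ih =>
    have hsum : MemLp (fun ω => ∑ j ∈ s, X j ω) (ENNReal.ofReal p) P :=
      memLp_finsetSum s fun j _ => hL j
    have hind : IndepFun (fun ω => ∑ j ∈ s, X j ω) (X i) P := by
      have := hX.indepFun_finsetSum_of_notMem hm hi
      convert this using 1
      ext ω; simp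
    have horth : ∫ ω, inner ℝ (‖∑ j ∈ s, X j ω‖ ^ (p - 2) • ∑ j ∈ s, X j ω) (X i ω) ∂P = 0 :=
      integral_inner_eq_zero_of_indepFun (H := fun ω => ∑ j ∈ s, X j ω) (B := X i)
        (φ := fun x => ‖x‖ ^ (p - 2) • x) (G := fun x => x.2)
        (Finset.measurable_sum s fun j _ => hm j) (hm i) hind (by fun_prop) measurable_snd
        (fun _ => (hL i).integrable hp1) (fun _ => h0 i)
        (integrable_inner_rpow_smul hp hsum (hL i))
    have := hsm _ _ hsum (hL i) horth
    simp only [Finset.sum_insert hi, mul_add]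
    simp only [add_comm (X i _)]
    linarith

namespace IsMartingaleDiff

variable {𝓕 : Filtration ℕ mΩ} {p : ℝ} {ζ : ℕ → Ω → E}

lemma measurable_sum (h : IsMartingaleDiff P 𝓕 p ζ) (n : ℕ) :
    Measurable[𝓕 n] fun ω => ∑ i ∈ Finset.range n, ζ i ω :=
  Finset.measurable_sum _ fun i hi =>
    (h.measurable i).mono (𝓕.mono (by have := Finset.mem_range.1 hi; omega)) le_rfl

lemma lpNorm_add_sq_le (h : IsMartingaleDiff P 𝓕 p ζ) (hp : 2 ≤ p) {C : ℝ}
    (hC : ∀ X ξ : Ω → E, MemLp X (ENNReal.ofReal p) P → MemLp ξ (ENNReal.ofReal p) P →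
      ∫ ω, inner ℝ (‖X ω‖ ^ (p - 2) • X ω) (ξ ω) ∂P = 0 →
      lpNorm (fun ω => X ω + ξ ω) (ENNReal.ofReal p) P ^ 2
        ≤ lpNorm X (ENNReal.ofReal p) P ^ 2 + C * lpNorm ξ (ENNReal.ofReal p) P ^ 2)
    {n : ℕ} {X : Ω → E} (hX : Measurable[𝓕 n] X) (hXL : MemLp X (ENNReal.ofReal p) P) :
    lpNorm (fun ω => X ω + ζ n ω) (ENNReal.ofReal p) P ^ 2
        ≤ lpNorm X (ENNReal.ofReal p) P ^ 2 + C * lpNorm (ζ n) (ENNReal.ofReal p) P ^ 2 :=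
  hC _ _ hXL (h.memLp n) (h.orthogonal n (fun ω => ‖X ω‖ ^ (p - 2) • X ω)
    ((by fun_prop : Measurable fun x : E => ‖x‖ ^ (p - 2) • x).comp hX)
    (integrable_inner_rpow_smul hp hXL (h.memLp n)))

/-- Burkholder's inequality with the `L^p` norms of the differences in place of the square function;
`C` is a constant of `2`-smoothness. -/
lemma lpNorm_sum_sq_le (h : IsMartingaleDiff P 𝓕 p ζ) (hp : 2 ≤ p) {C : ℝ}
    (hC : ∀ X ξ : Ω → E, MemLp X (ENNReal.ofReal p) P → MemLp ξ (ENNReal.ofReal p) P →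
      ∫ ω, inner ℝ (‖X ω‖ ^ (p - 2) • X ω) (ξ ω) ∂P = 0 →
      lpNorm (fun ω => X ω + ξ ω) (ENNReal.ofReal p) P ^ 2
        ≤ lpNorm X (ENNReal.ofReal p) P ^ 2 + C * lpNorm ξ (ENNReal.ofReal p) P ^ 2) (n : ℕ) :
    lpNorm (fun ω => ∑ i ∈ Finset.range n, ζ i ω) (ENNReal.ofReal p) P ^ 2
      ≤ C * ∑ i ∈ Finset.range n, lpNorm (ζ i) (ENNReal.ofReal p) P ^ 2 := by
  induction n with
  | zero => simp
  | succ n ih =>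
    have := h.lpNorm_add_sq_le hp hC (h.measurable_sum n) (h.memLp_sum n)
    simp only [Finset.sum_range_succ, mul_add]
    linarith

lemma measurable_maxSum (h : IsMartingaleDiff P 𝓕 p ζ) (n : ℕ) : Measurable[𝓕 n] (maxSum ζ n) := by
  induction n with
  | zero =>
    have : maxSum ζ 0 = fun _ => 0 := funext fun ω => maxSum_zero ζ ω
    rw [this]; exact measurable_const
  | succ n ih =>
    have : maxSum ζ (n + 1) = fun ω => max (maxSum ζ n ω) ‖∑ i ∈ Finset.range (n + 1), ζ i ω‖ :=
      funext fun ω => maxSum_succ ζ n ω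
    rw [this]
    exact (ih.mono (𝓕.mono n.le_succ) le_rfl).max (measurable_norm.comp (h.measurable_sum (n + 1)))

/-- The process `s̄ ^ (p - 1) s - s̄ ^ p / 2`, with `s` the norm of the martingale and `s̄` its running
maximum, has non-negative expectation, because it dominates a martingale transform. -/
lemma integral_rpow_mul_maxSum_nonneg (h : IsMartingaleDiff P 𝓕 p ζ) (hp : 2 ≤ p) (n : ℕ) :
    0 ≤ ∫ ω, (maxSum ζ n ω ^ (p - 1) * ‖∑ i ∈ Finset.range n, ζ i ω‖
      - 1 / 2 * maxSum ζ n ω ^ p) ∂P := by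
  induction n with
  | zero =>
    simp only [maxSum_zero, Finset.range_zero, Finset.sum_empty, norm_zero, mul_zero]
    rw [Real.zero_rpow (by linarith)]
    simp
  | succ n ih =>
    set M : Ω → E := fun ω => ∑ i ∈ Finset.range n, ζ i ω with hM
    -- the transform is directed along the unit vector `M / ‖M‖`, so that it bounds the increment of
    -- `‖M‖` from below; where `M = 0` the junk value `0⁻¹ = 0` gives `Y = 0`
    set Y : Ω → E := fun ω => (maxSum ζ n ω ^ (p - 1) * ‖M ω‖⁻¹) • M ω with hY
    have hYm : Measurable[𝓕 n] Y :=
      (by fun_prop : Measurable fun x : ℝ × E => (x.1 ^ (p - 1) * ‖x.2‖⁻¹) • x.2).comp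
        ((h.measurable_maxSum n).prodMk (h.measurable_sum n))
    have hYb (ω) : ‖Y ω‖ ≤ maxSum ζ n ω ^ (p - 1) := by
      have h0 := Real.rpow_nonneg (maxSum_nonneg ζ n ω) (p - 1)
      rw [hY, norm_smul, Real.norm_of_nonneg (by positivity), mul_assoc]
      exact mul_le_of_le_one_right h0 (inv_mul_le_one_of_le₀ le_rfl (norm_nonneg _))
    have hint : Integrable (fun ω => inner ℝ (Y ω) (ζ n ω)) P := by
      refine (h.integrable_rpow_mul_maxSum hp n (h.memLp n)).mono' ?_ (ae_of_all _ fun ω => ?_)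
      · exact (hYm.mono (𝓕.le n) le_rfl).aestronglyMeasurable.inner (h.memLp n).1
      · exact (norm_inner_le_norm _ _).trans
          (mul_le_mul_of_nonneg_right (hYb ω) (norm_nonneg _))
    have horth := h.orthogonal n Y hYm hint
    have hD := (h.integrable_rpow_mul_maxSum hp n (h.memLp_sum n)).sub
      ((h.integrable_rpow_maxSum hp n).const_mul (1 / 2))
    have hD' := (h.integrable_rpow_mul_maxSum hp (n + 1) (h.memLp_sum (n + 1))).sub
      ((h.integrable_rpow_maxSum hp (n + 1)).const_mul (1 / 2))
    have hsum : 0 ≤ ∫ ω, (maxSum ζ n ω ^ (p - 1) * ‖∑ i ∈ Finset.range n, ζ i ω‖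
        - 1 / 2 * maxSum ζ n ω ^ p) + inner ℝ (Y ω) (ζ n ω) ∂P := by
      have := integral_add hD hint
      rw [horth, add_zero] at this
      exact ih.trans_eq this.symm
    refine hsum.trans (integral_mono (hD.add hint) hD' fun ω => ?_)
    have hmax := rpow_mul_sub_half_rpow_le hp (maxSum_nonneg ζ n ω)
      (norm_nonneg (∑ i ∈ Finset.range (n + 1), ζ i ω))
    rw [← maxSum_succ] at hmax
    refine le_trans ?_ hmax
    have h0 := Real.rpow_nonneg (maxSum_nonneg ζ n ω) (p - 1)
    have hproj : ‖M ω‖ + inner ℝ (‖M ω‖⁻¹ • M ω) (ζ n ω)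
        ≤ ‖∑ i ∈ Finset.range (n + 1), ζ i ω‖ := by
      rw [Finset.sum_range_succ]
      change _ ≤ ‖M ω + ζ n ω‖
      rcases eq_or_ne (M ω) 0 with h0 | h0
      · simp [h0]
      · have hpos := norm_pos_iff.2 h0
        have hu : ‖‖M ω‖⁻¹ • M ω‖ = 1 := by
          rw [norm_smul, norm_inv, norm_norm, inv_mul_cancel₀ hpos.ne']
        have := real_inner_le_norm (‖M ω‖⁻¹ • M ω) (M ω + ζ n ω)
        rw [hu, one_mul, inner_add_right, real_inner_smul_left (M ω) (M ω),
          real_inner_self_eq_norm_sq] at this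
        refine le_trans (le_of_eq ?_) this
        congr 1
        field_simp
    have := mul_le_mul_of_nonneg_left hproj h0
    have e : inner ℝ (Y ω) (ζ n ω)
        = maxSum ζ n ω ^ (p - 1) * inner ℝ (‖M ω‖⁻¹ • M ω) (ζ n ω) := by
      rw [hY, ← real_inner_smul_left, smul_smul]
    change maxSum ζ n ω ^ (p - 1) * ‖M ω‖ - 1 / 2 * maxSum ζ n ω ^ p + inner ℝ (Y ω) (ζ n ω) ≤ _
    rw [e]
    linarith

/-- Doob's maximal inequality in `L^p` for `p ≥ 2`. -/
theorem lpNorm_maxSum_le (h : IsMartingaleDiff P 𝓕 p ζ) (hp : 2 ≤ p) (n : ℕ) :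
    lpNorm (maxSum ζ n) (ENNReal.ofReal p) P
      ≤ 2 * lpNorm (fun ω => ∑ i ∈ Finset.range n, ζ i ω) (ENNReal.ofReal p) P := by
  have h0 := h.integral_rpow_mul_maxSum_nonneg hp n
  rw [integral_sub (h.integrable_rpow_mul_maxSum hp n (h.memLp_sum n))
      ((h.integrable_rpow_maxSum hp n).const_mul (1 / 2)), integral_const_mul] at h0
  have hH := (integral_rpow_mul_rpow_le (s := p - 1) (t := 1) (by linarith) (by linarith) (by simp)
    (by ring) (h.memLp_maxSum n) (h.memLp_sum n)).2
  have hI := integral_norm_rpow_eq_lpNorm (p := p) (by linarith) (h.memLp_maxSum n).1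
  simp only [Real.rpow_one, Real.norm_of_nonneg (maxSum_nonneg ζ n _)] at hH hI
  rw [hI] at h0
  set a := lpNorm (maxSum ζ n) (ENNReal.ofReal p) P with hadef
  set b := lpNorm (fun ω => ∑ i ∈ Finset.range n, ζ i ω) (ENNReal.ofReal p) P
  have hb : 0 ≤ b := lpNorm_nonneg
  have ha0 : 0 ≤ a := lpNorm_nonneg
  clear_value a
  rcases eq_or_lt_of_le ha0 with ha | ha
  · rw [← ha]; positivity
  have e : a ^ p = a ^ (p - 1) * a := by
    rw [← Real.rpow_add_one ha.ne']; ring_nf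
  have hpos : 0 < a ^ (p - 1) := Real.rpow_pos_of_pos ha _
  rw [e] at h0
  have : a ^ (p - 1) * a ≤ a ^ (p - 1) * (2 * b) := by linarith
  exact le_of_mul_le_mul_left this hpos

end IsMartingaleDiff

end MLRM

/-! ### Decay of real sequences and affine bounds for `L^p` norms -/

namespace MLRM

/-- A contraction rate `lam / m` with `lam > ρ` beats the growth of `m ^ ρ` in one step. -/
lemma exists_one_sub_div_mul_rpow_le {ρ lam : ℝ} (hρ : 0 < ρ) (hlam : ρ < lam) :
    ∃ μ : ℝ, 0 < μ ∧ ∃ n₁ : ℕ, 1 ≤ n₁ ∧ ∀ n : ℕ, n₁ ≤ n → lam / (n + 1) ≤ 1 ∧ μ / (n + 1) ≤ 1 ∧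
      (1 - lam / (n + 1)) * (n : ℝ) ^ (-ρ) ≤ (1 - μ / (n + 1)) * ((n : ℝ) + 1) ^ (-ρ) := by
  have hd : 0 < lam - ρ := by linarith
  refine ⟨(lam - ρ) / 4, by linarith, ?_⟩
  obtain ⟨N, hN⟩ := exists_nat_ge (max lam ((lam + ρ) / (lam - ρ)))
  refine ⟨N + 1, by omega, fun n hn => ?_⟩
  have hnN : (N : ℝ) + 1 ≤ n := by exact_mod_cast hn
  have hN1 := (le_max_left _ _).trans hN
  have hN2 := (le_max_right _ _).trans hN
  rw [div_le_iff₀ hd] at hN2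
  have hn0 : (0 : ℝ) < n := by have := N.cast_nonneg (α := ℝ); linarith
  have hm : (0 : ℝ) < n + 1 := by linarith
  have h1 : lam / (n + 1) ≤ 1 := by rw [div_le_one hm]; linarith
  refine ⟨h1, by rw [div_le_one hm]; linarith, ?_⟩
  set x := 2 * ((lam - ρ) / 4) / (n + 1) with hx
  have hx0 : 0 ≤ x := by positivity
  have hx1 : x ≤ 1 := by rw [hx, div_le_one hm]; linarith
  have e1 : 1 - lam / (n + 1) ≤ Real.exp (-(lam / (n + 1))) := Real.one_sub_le_exp_neg _
  have e2 : (n : ℝ) ^ (-ρ) ≤ Real.exp (ρ / n) * ((n : ℝ) + 1) ^ (-ρ) := by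
    have h := Real.add_one_le_exp (1 / (n : ℝ))
    have h2 := Real.rpow_le_rpow (by positivity) h hρ.le
    rw [← Real.exp_mul] at h2
    have h3 : (1 / (n : ℝ) + 1) ^ ρ = ((n : ℝ) + 1) ^ ρ * (n : ℝ) ^ (-ρ) := by
      rw [Real.rpow_neg hn0.le, ← div_eq_mul_inv, ← Real.div_rpow hm.le hn0.le]
      congr 1; field_simp; ring
    rw [h3] at h2
    have h4 := mul_le_mul_of_nonneg_right h2 (Real.rpow_nonneg hm.le (-ρ))
    have h5 : ((n : ℝ) + 1) ^ ρ * ((n : ℝ) + 1) ^ (-ρ) = 1 := by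
      rw [← Real.rpow_add hm]; simp
    calc (n : ℝ) ^ (-ρ) = ((n : ℝ) + 1) ^ ρ * (n : ℝ) ^ (-ρ) * ((n : ℝ) + 1) ^ (-ρ) := by
          linear_combination -(n : ℝ) ^ (-ρ) * h5
      _ ≤ _ := by rwa [show ρ / (n : ℝ) = 1 / n * ρ by ring]
  have e3 : Real.exp (-(lam / (n + 1))) * Real.exp (ρ / n) ≤ Real.exp (-x) := by
    rw [← Real.exp_add]
    refine Real.exp_le_exp.2 ?_
    have : -(lam / (n + 1)) + ρ / n - -x = (ρ * (n + 1) - (lam + ρ) / 2 * n) / (n * (n + 1)) := by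
      rw [hx]; field_simp; ring
    have h' : (ρ * (n + 1) - (lam + ρ) / 2 * n) / (n * (n + 1)) ≤ 0 := by
      refine div_nonpos_of_nonpos_of_nonneg ?_ (by positivity)
      nlinarith
    linarith
  have e4 : Real.exp (-x) ≤ 1 - x / 2 := by
    rw [Real.exp_neg, inv_le_comm₀ (Real.exp_pos _) (by linarith)]
    refine le_trans ?_ (Real.add_one_le_exp x)
    rw [inv_le_iff_one_le_mul₀ (by linarith)]
    nlinarith
  have e5 : x / 2 = (lam - ρ) / 4 / (n + 1) := by rw [hx]; ring
  have hr := Real.rpow_nonneg hm.le (-ρ)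
  calc (1 - lam / (n + 1)) * (n : ℝ) ^ (-ρ)
      ≤ Real.exp (-(lam / (n + 1))) * (Real.exp (ρ / n) * ((n : ℝ) + 1) ^ (-ρ)) :=
        mul_le_mul e1 e2 (by positivity) (Real.exp_pos _).le
    _ = Real.exp (-(lam / (n + 1))) * Real.exp (ρ / n) * ((n : ℝ) + 1) ^ (-ρ) := by ring
    _ ≤ (1 - (lam - ρ) / 4 / (n + 1)) * ((n : ℝ) + 1) ^ (-ρ) := by
        rw [← e5]
        exact mul_le_mul_of_nonneg_right (e3.trans e4) hr

/-- Rate of decay of a real sequence governed by the contraction factors `1 - lam / n`, a drift error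
of order `n ^ (-1 - ρ)` and a squared noise of order `n ^ (-1 - 2 ρ)`. -/
lemma exists_le_mul_rpow_neg {ρ lam c c' : ℝ} (hρ : 0 < ρ) (hlam : ρ < lam) (hc : 0 ≤ c)
    (hc' : 0 ≤ c') {x : ℕ → ℝ} (hx : ∀ n, 0 ≤ x n) {n₀ : ℕ}
    (hrec : ∀ n : ℕ, n₀ ≤ n → lam / (n + 1) ≤ 1 → x (n + 1) ^ 2
      ≤ ((1 - lam / (n + 1)) * x n + c * ((n : ℝ) + 1) ^ (-(1 + ρ))) ^ 2
        + c' * ((n : ℝ) + 1) ^ (-(1 + 2 * ρ))) :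
    ∃ K : ℝ, 0 < K ∧ ∀ n : ℕ, 1 ≤ n → x n ≤ K * (n : ℝ) ^ (-ρ) := by
  obtain ⟨μ, hμ, n₁, hn₁, hstep⟩ := exists_one_sub_div_mul_rpow_le hρ hlam
  set N := max n₀ n₁ with hN
  -- the sum covers the indices up to `N`, the other terms absorb drift error and noise beyond `N`
  set K := 1 + 2 * c / μ + 2 * c' / μ + ∑ i ∈ Finset.range (N + 1), x i * (i : ℝ) ^ ρ with hK
  have hsum : 0 ≤ ∑ i ∈ Finset.range (N + 1), x i * (i : ℝ) ^ ρ :=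
    Finset.sum_nonneg fun i _ => mul_nonneg (hx i) (by positivity)
  have q1 : 0 ≤ 2 * c / μ := by positivity
  have q2 : 0 ≤ 2 * c' / μ := by positivity
  have hK1 : 1 ≤ K := by linarith
  have hKc : c ≤ K * (μ / 2) := by
    have : 2 * c / μ ≤ K := by linarith
    rw [div_le_iff₀ hμ] at this; linarith
  have hKc' : c' ≤ K ^ 2 * (μ / 2) := by
    have : 2 * c' / μ ≤ K := by linarith
    rw [div_le_iff₀ hμ] at this
    nlinarith
  refine ⟨K, by linarith, ?_⟩
  have hsmall : ∀ n : ℕ, 1 ≤ n → n ≤ N → x n ≤ K * (n : ℝ) ^ (-ρ) := by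
    intro n h1 hn
    have hn0 : (0 : ℝ) < n := by exact_mod_cast h1
    have := Finset.single_le_sum (f := fun i : ℕ => x i * (i : ℝ) ^ ρ)
      (fun i _ => mul_nonneg (hx i) (by positivity)) (Finset.mem_range.2 (Nat.lt_succ_of_le hn))
    rw [Real.rpow_neg hn0.le, ← div_eq_mul_inv, le_div_iff₀ (Real.rpow_pos_of_pos hn0 _)]
    linarith
  have hlarge : ∀ n : ℕ, N ≤ n → x n ≤ K * (n : ℝ) ^ (-ρ) := by
    intro n hn
    induction n, hn using Nat.le_induction with
    | base => exact hsmall N (hn₁.trans (le_max_right _ _)) le_rfl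
    | succ n hn ih =>
      obtain ⟨h1, h2, h3⟩ := hstep n ((le_max_right _ _).trans hn)
      have hr := hrec n ((le_max_left _ _).trans hn) h1
      have hm : (0 : ℝ) < n + 1 := by positivity
      set z := ((n : ℝ) + 1) ^ (-ρ) with hz
      have hz0 : 0 ≤ z := Real.rpow_nonneg hm.le _
      have ez1 : ((n : ℝ) + 1) ^ (-(1 + ρ)) = z / (n + 1) := by
        rw [hz, neg_add_rev, Real.rpow_add hm, Real.rpow_neg_one, div_eq_mul_inv]
      have ez2 : ((n : ℝ) + 1) ^ (-(1 + 2 * ρ)) = z ^ 2 / (n + 1) := by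
        rw [hz, ← Real.rpow_natCast, ← Real.rpow_mul hm.le, neg_add_rev, Real.rpow_add hm,
          Real.rpow_neg_one, div_eq_mul_inv]
        congr 2; push_cast; ring
      rw [ez1, ez2] at hr
      have hA : (1 - lam / (n + 1)) * x n + c * (z / (n + 1)) ≤ K * z * (1 - μ / 2 / (n + 1)) := by
        have a1 : (1 - lam / (n + 1)) * x n ≤ (1 - lam / (n + 1)) * (K * (n : ℝ) ^ (-ρ)) :=
          mul_le_mul_of_nonneg_left ih (by linarith)
        have a2 := mul_le_mul_of_nonneg_left h3 (by linarith : 0 ≤ K)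
        have a3 : c * (z / (n + 1)) ≤ K * (μ / 2) * (z / (n + 1)) :=
          mul_le_mul_of_nonneg_right hKc (by positivity)
        have a4 : K * z * (1 - μ / 2 / (n + 1))
            = K * ((1 - μ / (n + 1)) * z) + K * (μ / 2) * (z / (n + 1)) := by
          field_simp; ring
        rw [a4]; linarith
      have hA0 : 0 ≤ (1 - lam / (n + 1)) * x n + c * (z / (n + 1)) :=
        add_nonneg (mul_nonneg (by linarith) (hx n)) (by positivity)
      set w := μ / 2 / ((n : ℝ) + 1) with hw
      have hw0 : 0 ≤ w := by positivity
      have hw1 : w ≤ 1 := by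
        have : w = μ / (n + 1) / 2 := by rw [hw]; ring
        linarith
      have hsq := pow_le_pow_left₀ hA0 hA 2
      have b1 : (K * z * (1 - w)) ^ 2 ≤ K ^ 2 * z ^ 2 * (1 - w) := by
        have : (1 - w) ^ 2 ≤ 1 - w := by nlinarith
        calc _ = K ^ 2 * z ^ 2 * (1 - w) ^ 2 := by ring
          _ ≤ _ := mul_le_mul_of_nonneg_left this (by positivity)
      have b2 : c' * (z ^ 2 / (n + 1)) ≤ K ^ 2 * z ^ 2 * w := by
        calc _ ≤ K ^ 2 * (μ / 2) * (z ^ 2 / (n + 1)) :=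
              mul_le_mul_of_nonneg_right hKc' (by positivity)
          _ = _ := by rw [hw]; ring
      have hsplit : (K * z) ^ 2 = K ^ 2 * z ^ 2 * (1 - w) + K ^ 2 * z ^ 2 * w := by ring
      have : x (n + 1) ^ 2 ≤ (K * z) ^ 2 := by linarith
      have := (sq_le_sq₀ (hx _) (mul_nonneg (by linarith) hz0)).1 this
      push_cast
      exact this
  intro n h1
  rcases le_total n N with h | h
  · exact hsmall n h1 h
  · exact hlarge n h

section

variable {E F Ω : Type*} [NormedAddCommGroup E] [NormedAddCommGroup F] [MeasurableSpace Ω]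
  {P : Measure Ω} [IsProbabilityMeasure P]

lemma lpNorm_le_affine {q : ℝ≥0∞} (hq : 1 ≤ q) {X : Ω → E} {Y : Ω → F} (hY : MemLp Y q P)
    {a b : ℝ} (ha : 0 ≤ a) (hb : 0 ≤ b) (h : ∀ ω, ‖X ω‖ ≤ a * ‖Y ω‖ + b) :
    lpNorm X q P ≤ a * lpNorm Y q P + b := by
  have h1 : MemLp (a • fun ω => ‖Y ω‖) q P := hY.norm.const_smul a
  have h2 : MemLp (fun _ : Ω => b) q P := memLp_const b
  have h3 := lpNorm_mono_real (f := X) (h1.add h2) (by simpa using h)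
  refine h3.trans ((lpNorm_add_le h1 hq).trans (le_of_eq ?_))
  rw [lpNorm_const_smul, lpNorm_const (by positivity) (IsProbabilityMeasure.ne_zero P)]
  have := lpNorm_norm hY.1 q
  simp [Real.norm_of_nonneg ha, Real.norm_of_nonneg hb, this]

lemma memLp_of_norm_le_affine {q : ℝ≥0∞} {X : Ω → E} {Y : Ω → F} (hX : AEStronglyMeasurable X P)
    (hY : MemLp Y q P) {a b : ℝ} (h : ∀ ω, ‖X ω‖ ≤ a * ‖Y ω‖ + b) : MemLp X q P :=
  ((hY.norm.const_mul a).add (memLp_const b)).mono' hX (ae_of_all _ h)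

end

end MLRM

/-! ### Contractive recursions with martingale noise -/

namespace MLRM

variable {E : Type*} [NormedAddCommGroup E] [InnerProductSpace ℝ E] [MeasurableSpace E]
variable {Ω : Type*} [mΩ : MeasurableSpace Ω] {P : Measure Ω}

/-- An error process `e` with increments `d n + ζ n`, where `ζ` is a martingale difference noise with
`L^p` norms of order `n ^ (-1/2 - ρ)`, and the drift `d` is at most of order `n⁻¹ ‖e n‖`, up to an
error of order `n ^ (-1 - ρ)`, and eventually contracts by the factor `1 - lam / n` up to the same
error. -/
structure IsContractiveRecursion (P : Measure Ω) (𝓕 : Filtration ℕ mΩ) (p lam ρ c : ℝ)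
    (e d ζ : ℕ → Ω → E) : Prop where
  noise : IsMartingaleDiff P 𝓕 p ζ
  memLp_zero : MemLp (e 0) (ENNReal.ofReal p) P
  measurable_zero : Measurable[𝓕 0] (e 0)
  measurable_drift : ∀ n, Measurable[𝓕 n] (d n)
  step : ∀ n ω, e (n + 1) ω = e n ω + d n ω + ζ n ω
  norm_drift_le : ∀ n ω, ‖d n ω‖ ≤ c / (n + 1) * ‖e n ω‖ + c * ((n : ℝ) + 1) ^ (-(1 + ρ))
  contraction : ∃ n₀ : ℕ, ∀ n, n₀ ≤ n → ∀ ω,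
    ‖e n ω + d n ω‖ ≤ (1 - lam / (n + 1)) * ‖e n ω‖ + c * ((n : ℝ) + 1) ^ (-(1 + ρ))
  lpNorm_noise_le : ∀ n, lpNorm (ζ n) (ENNReal.ofReal p) P ≤ c * ((n : ℝ) + 1) ^ (-(1 / 2 + ρ))
  nonneg : 0 ≤ c

namespace IsContractiveRecursion

variable {𝓕 : Filtration ℕ mΩ} {p lam ρ c : ℝ} {e d ζ : ℕ → Ω → E}

lemma eq_add_sum (h : IsContractiveRecursion P 𝓕 p lam ρ c e d ζ) (n k : ℕ) (ω : Ω) :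
    e (n + k) ω = e n ω + ∑ i ∈ Finset.range k, d (n + i) ω
      + ∑ i ∈ Finset.range k, ζ (n + i) ω := by
  induction k with
  | zero => simp
  | succ k ih =>
    rw [← add_assoc, h.step, ih, Finset.sum_range_succ, Finset.sum_range_succ]
    abel

variable [BorelSpace E] [FiniteDimensional ℝ E]

lemma measurable (h : IsContractiveRecursion P 𝓕 p lam ρ c e d ζ) (n : ℕ) :
    Measurable[𝓕 n] (e n) := by
  induction n with
  | zero => exact h.measurable_zero
  | succ n ih =>
    have hn := 𝓕.mono n.le_succ
    have : e (n + 1) = fun ω => e n ω + d n ω + ζ n ω := funext (h.step n)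
    rw [this]
    exact ((ih.mono hn le_rfl).add ((h.measurable_drift n).mono hn le_rfl)).add
      (h.noise.measurable n)

variable [IsProbabilityMeasure P]

lemma memLp_drift_of_memLp (h : IsContractiveRecursion P 𝓕 p lam ρ c e d ζ) {n : ℕ}
    (he : MemLp (e n) (ENNReal.ofReal p) P) : MemLp (d n) (ENNReal.ofReal p) P :=
  memLp_of_norm_le_affine ((h.measurable_drift n).mono (𝓕.le n) le_rfl).aestronglyMeasurable he
    (h.norm_drift_le n)

lemma memLp (h : IsContractiveRecursion P 𝓕 p lam ρ c e d ζ) (n : ℕ) :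
    MemLp (e n) (ENNReal.ofReal p) P := by
  induction n with
  | zero => exact h.memLp_zero
  | succ n ih =>
    have : e (n + 1) = fun ω => e n ω + d n ω + ζ n ω := funext (h.step n)
    rw [this]
    exact (ih.add (h.memLp_drift_of_memLp ih)).add (h.noise.memLp n)

lemma memLp_drift (h : IsContractiveRecursion P 𝓕 p lam ρ c e d ζ) (n : ℕ) :
    MemLp (d n) (ENNReal.ofReal p) P :=
  h.memLp_drift_of_memLp (h.memLp n)

/-- The `L^p` norm of the error decays with the rate `n ^ (-ρ)`. -/
theorem exists_lpNorm_le (h : IsContractiveRecursion P 𝓕 p lam ρ c e d ζ) (hp : 2 ≤ p)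
    (hρ : 0 < ρ) (hlam : ρ < lam) :
    ∃ K : ℝ, 0 < K ∧ ∀ n : ℕ, 1 ≤ n → lpNorm (e n) (ENNReal.ofReal p) P ≤ K * (n : ℝ) ^ (-ρ) := by
  obtain ⟨C, hC, hsm⟩ := exists_lpNorm_add_sq_le (E := E) hp P
  obtain ⟨n₀, hn₀⟩ := h.contraction
  have hp1 : 1 ≤ ENNReal.ofReal p := by
    rw [← ENNReal.ofReal_one]; exact ENNReal.ofReal_le_ofReal (by linarith)
  have hc := h.nonneg
  refine exists_le_mul_rpow_neg (c := c) (c' := C * c ^ 2) (n₀ := n₀) hρ hlam hc (by positivity)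
    (fun n => lpNorm_nonneg) fun n hn hl => ?_
  have hm : (0 : ℝ) < n + 1 := by positivity
  have hX : MemLp (fun ω => e n ω + d n ω) (ENNReal.ofReal p) P := (h.memLp n).add (h.memLp_drift n)
  have hXm : Measurable[𝓕 n] fun ω => e n ω + d n ω := (h.measurable n).add (h.measurable_drift n)
  have h1 := h.noise.lpNorm_add_sq_le hp hsm hXm hX
  have h2 : e (n + 1) = fun ω => e n ω + d n ω + ζ n ω := funext (h.step n)
  rw [← h2] at h1
  have h3 := lpNorm_le_affine hp1 (h.memLp n) (by linarith) (by positivity) (hn₀ n hn)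
  refine h1.trans (add_le_add (pow_le_pow_left₀ lpNorm_nonneg h3 2) ?_)
  have h4 := pow_le_pow_left₀ lpNorm_nonneg (h.lpNorm_noise_le n) 2
  have e1 : (((n : ℝ) + 1) ^ (-(1 / 2 + ρ))) ^ 2 = ((n : ℝ) + 1) ^ (-(1 + 2 * ρ)) := by
    rw [← Real.rpow_natCast, ← Real.rpow_mul hm.le]; congr 1; push_cast; ring
  rw [mul_pow, e1] at h4
  rw [mul_assoc]
  exact mul_le_mul_of_nonneg_left h4 (by linarith)

/-- On a block `n ≤ k ≤ 2 n` the maximal error is of the same order as the error at time `n`: the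
drift is summed trivially, the noise is controlled by Doob's inequality. -/
theorem exists_block_bound (h : IsContractiveRecursion P 𝓕 p lam ρ c e d ζ) (hp : 2 ≤ p)
    (hρ : 0 < ρ) (hlam : ρ < lam) :
    ∃ K : ℝ, 0 < K ∧ ∀ n : ℕ, 1 ≤ n → ∃ R : Ω → ℝ, MemLp R (ENNReal.ofReal p) P ∧
      lpNorm R (ENNReal.ofReal p) P ≤ K * (n : ℝ) ^ (-ρ) ∧
      ∀ k, n ≤ k → k ≤ 2 * n → ∀ ω, ‖e k ω‖ ≤ R ω := by
  obtain ⟨K, hK, hKn⟩ := h.exists_lpNorm_le hp hρ hlam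
  obtain ⟨C, hC, hsm⟩ := exists_lpNorm_add_sq_le (E := E) hp P
  have hp1 : 1 ≤ ENNReal.ofReal p := by
    rw [← ENNReal.ofReal_one]; exact ENNReal.ofReal_le_ofReal (by linarith)
  have hc := h.nonneg
  refine ⟨K + (c * K + c) + 2 * (C * c), by positivity, fun n hn => ?_⟩
  have hn0 : (0 : ℝ) < n := by exact_mod_cast hn
  have hS := h.noise.shift n
  set z := (n : ℝ) ^ (-ρ) with hz
  have hz0 : 0 ≤ z := by positivity
  have hDL : MemLp (fun ω => ∑ i ∈ Finset.range n, ‖d (n + i) ω‖) (ENNReal.ofReal p) P :=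
    memLp_finsetSum _ fun i _ => (h.memLp_drift (n + i)).norm
  have hML := hS.memLp_maxSum n
  refine ⟨fun ω => ‖e n ω‖ + ∑ i ∈ Finset.range n, ‖d (n + i) ω‖ + maxSum (fun i => ζ (n + i)) n ω,
    ((h.memLp n).norm.add hDL).add hML, ?_, fun k hk hk2 ω => ?_⟩
  · have t1 := lpNorm_add_le (g := maxSum (fun i => ζ (n + i)) n) ((h.memLp n).norm.add hDL) hp1
    have t2 := lpNorm_add_le (g := fun ω => ∑ i ∈ Finset.range n, ‖d (n + i) ω‖)
      (h.memLp n).norm hp1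
    rw [lpNorm_norm (h.memLp n).1] at t2
    have t3 : lpNorm (fun ω => ∑ i ∈ Finset.range n, ‖d (n + i) ω‖) (ENNReal.ofReal p) P
        ≤ (c * K + c) * z := by
      have e1 : (fun ω => ∑ i ∈ Finset.range n, ‖d (n + i) ω‖)
          = ∑ i ∈ Finset.range n, fun ω => ‖d (n + i) ω‖ := by ext ω; simp
      rw [e1]
      refine (lpNorm_sum_le (fun i _ => (h.memLp_drift (n + i)).norm) hp1).trans ?_
      have e2 : (c * K + c) * z = ∑ i ∈ Finset.range n, (c * K + c) * (z / n) := by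
        rw [Finset.sum_const, Finset.card_range, nsmul_eq_mul]; field_simp
      rw [e2]
      refine Finset.sum_le_sum fun i _ => ?_
      rw [lpNorm_norm (h.memLp_drift (n + i)).1]
      have hmi : (n : ℝ) ≤ ((n + i : ℕ) : ℝ) := by push_cast; linarith [i.cast_nonneg (α := ℝ)]
      have hmi0 := hn0.trans_le hmi
      have b := lpNorm_le_affine hp1 (h.memLp (n + i)) (by positivity) (by positivity)
        (h.norm_drift_le (n + i))
      refine b.trans ?_
      have b1 : c / (((n + i : ℕ) : ℝ) + 1) ≤ c / n := by gcongr; linarith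
      have b2 : lpNorm (e (n + i)) (ENNReal.ofReal p) P ≤ K * z :=
        (hKn (n + i) (by omega)).trans (mul_le_mul_of_nonneg_left
          (Real.rpow_le_rpow_of_nonpos hn0 hmi (by linarith)) hK.le)
      have b3 : (((n + i : ℕ) : ℝ) + 1) ^ (-(1 + ρ)) ≤ z / n := by
        calc _ ≤ (n : ℝ) ^ (-(1 + ρ)) :=
              Real.rpow_le_rpow_of_nonpos hn0 (by linarith) (by linarith)
          _ = z / n := by
              rw [hz, neg_add_rev, Real.rpow_add hn0, Real.rpow_neg_one, div_eq_mul_inv]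
      calc _ ≤ c / n * (K * z) + c * (z / n) :=
            add_le_add (mul_le_mul b1 b2 lpNorm_nonneg (by positivity))
              (mul_le_mul_of_nonneg_left b3 hc)
        _ = _ := by ring
    have t4 : lpNorm (maxSum (fun i => ζ (n + i)) n) (ENNReal.ofReal p) P ≤ 2 * (C * c * z) := by
      refine (hS.lpNorm_maxSum_le hp n).trans (mul_le_mul_of_nonneg_left ?_ (by norm_num))
      have s1 := hS.lpNorm_sum_sq_le hp hsm n
      have s2 : ∑ i ∈ Finset.range n, lpNorm (ζ (n + i)) (ENNReal.ofReal p) P ^ 2 ≤ c ^ 2 * z ^ 2 := by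
        have e2 : c ^ 2 * z ^ 2 = ∑ i ∈ Finset.range n, c ^ 2 * (z ^ 2 / n) := by
          rw [Finset.sum_const, Finset.card_range, nsmul_eq_mul]; field_simp
        rw [e2]
        refine Finset.sum_le_sum fun i _ => ?_
        have hmi : (n : ℝ) ≤ ((n + i : ℕ) : ℝ) := by push_cast; linarith [i.cast_nonneg (α := ℝ)]
        have h4 := pow_le_pow_left₀ lpNorm_nonneg (h.lpNorm_noise_le (n + i)) 2
        refine h4.trans ?_
        rw [mul_pow]
        refine mul_le_mul_of_nonneg_left ?_ (by positivity)
        calc ((((n + i : ℕ) : ℝ) + 1) ^ (-(1 / 2 + ρ))) ^ 2 ≤ ((n : ℝ) ^ (-(1 / 2 + ρ))) ^ 2 := by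
              refine pow_le_pow_left₀ (by positivity) ?_ 2
              exact Real.rpow_le_rpow_of_nonpos hn0 (by linarith) (by linarith)
          _ = z ^ 2 / n := by
              rw [hz, ← Real.rpow_natCast, ← Real.rpow_natCast, ← Real.rpow_mul hn0.le,
                ← Real.rpow_mul hn0.le, ← Real.rpow_sub_one hn0.ne']
              congr 1; push_cast; ring
      have s3 : lpNorm (fun ω => ∑ i ∈ Finset.range n, ζ (n + i) ω) (ENNReal.ofReal p) P ^ 2
          ≤ (C * c * z) ^ 2 := by
        refine s1.trans ((mul_le_mul_of_nonneg_left s2 (by linarith)).trans ?_)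
        have : 0 ≤ c ^ 2 * z ^ 2 := by positivity
        have hCC : C ≤ C ^ 2 := by nlinarith
        calc C * (c ^ 2 * z ^ 2) ≤ C ^ 2 * (c ^ 2 * z ^ 2) := mul_le_mul_of_nonneg_right hCC this
          _ = _ := by ring
      exact (sq_le_sq₀ lpNorm_nonneg (by positivity)).1 s3
    have t5 := hKn n hn
    refine t1.trans ?_
    calc _ ≤ (K * z + (c * K + c) * z) + 2 * (C * c * z) :=
          add_le_add (t2.trans (add_le_add t5 t3)) t4
      _ = _ := by ring
  · obtain ⟨j, rfl⟩ := Nat.exists_eq_add_of_le hk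
    rw [h.eq_add_sum]
    refine (norm_add_le _ _).trans (add_le_add ((norm_add_le _ _).trans (add_le_add le_rfl ?_)) ?_)
    · refine (norm_sum_le _ _).trans (Finset.sum_le_sum_of_subset_of_nonneg ?_ fun _ _ _ =>
        norm_nonneg _)
      exact Finset.range_subset_range.2 (by omega)
    · exact norm_sum_le_maxSum (fun i => ζ (n + i)) (by omega) ω

/-- Weighted maximal inequality: the blocks `2 ^ i n ≤ k ≤ 2 ^ (i + 1) n` contribute a geometric
series. -/
theorem exists_lintegral_iSup_le (h : IsContractiveRecursion P 𝓕 p lam ρ c e d ζ) (hp : 2 ≤ p)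
    (hρ : 0 < ρ) (hlam : ρ < lam) {η : ℝ} (hη : 0 < η) (hηρ : η < ρ) :
    ∃ κ : ℝ, 0 < κ ∧ ∀ n : ℕ, 1 ≤ n →
      (∫⁻ ω, ⨆ k : ℕ, ⨆ _ : n ≤ k, ENNReal.ofReal ((k : ℝ) ^ (η * p) * ‖e k ω‖ ^ p) ∂P) ^ (1 / p)
        ≤ ENNReal.ofReal (κ * (n : ℝ) ^ (-(ρ - η))) := by
  obtain ⟨K, hK, hblock⟩ := h.exists_block_bound hp hρ hlam
  have hp0 : 0 < p := by linarith
  set q : ℝ := 2 ^ (-((ρ - η) * p)) with hq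
  have hq0 : 0 < q := by positivity
  have hq1 : q < 1 := Real.rpow_lt_one_of_one_lt_of_neg (by norm_num)
    (neg_lt_zero.2 (mul_pos (by linarith) hp0))
  have h1q : 0 < 1 - q := by linarith
  set A : ℝ := 2 ^ (η * p) * K ^ p * (1 - q)⁻¹ with hA
  have hA0 : 0 < A := by positivity
  refine ⟨A ^ (1 / p), by positivity, fun n hn => ?_⟩
  have hn0 : (0 : ℝ) < n := by exact_mod_cast hn
  have hN (i : ℕ) : 1 ≤ 2 ^ i * n := Nat.one_le_iff_ne_zero.2 (by positivity)
  choose R hRL hRn hRe using fun i => hblock (2 ^ i * n) (hN i)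
  have hterm (i : ℕ) : ∫⁻ ω, ENNReal.ofReal ((2 * (2 ^ i * n : ℕ) : ℝ) ^ (η * p) * ‖R i ω‖ ^ p) ∂P
      ≤ ENNReal.ofReal (2 ^ (η * p) * K ^ p * (n : ℝ) ^ (-((ρ - η) * p)) * q ^ i) := by
    have hx : (0 : ℝ) < (2 ^ i * n : ℕ) := by exact_mod_cast hN i
    rw [← ofReal_integral_eq_lintegral_ofReal
      ((integrable_norm_rpow_ofReal hp0 (hRL i)).const_mul _) (ae_of_all _ fun ω => by positivity),
      integral_const_mul, integral_norm_rpow_eq_lpNorm hp0 (hRL i).1]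
    refine ENNReal.ofReal_le_ofReal ?_
    have h1 := Real.rpow_le_rpow lpNorm_nonneg (hRn i) hp0.le
    refine (mul_le_mul_of_nonneg_left h1 (by positivity)).trans (le_of_eq ?_)
    have e1 : q ^ i = ((2 : ℝ) ^ i) ^ (-((ρ - η) * p)) := by
      rw [hq, ← Real.rpow_natCast, ← Real.rpow_natCast, ← Real.rpow_mul (by norm_num),
        ← Real.rpow_mul (by norm_num), mul_comm]
    have e2 : ((2 ^ i * n : ℕ) : ℝ) ^ (-((ρ - η) * p)) = (n : ℝ) ^ (-((ρ - η) * p)) * q ^ i := by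
      push_cast
      rw [e1, Real.mul_rpow (by positivity) hn0.le, mul_comm]
    rw [Real.mul_rpow (by norm_num) hx.le, Real.mul_rpow hK.le (by positivity),
      ← Real.rpow_mul hx.le]
    calc _ = 2 ^ (η * p) * K ^ p * (((2 ^ i * n : ℕ) : ℝ) ^ (η * p)
            * ((2 ^ i * n : ℕ) : ℝ) ^ (-ρ * p)) := by ring
      _ = _ := by
        rw [← Real.rpow_add hx, show η * p + -ρ * p = -((ρ - η) * p) by ring, e2]; ring
  have hsup (ω : Ω) : (⨆ k : ℕ, ⨆ _ : n ≤ k, ENNReal.ofReal ((k : ℝ) ^ (η * p) * ‖e k ω‖ ^ p))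
      ≤ ∑' i, ENNReal.ofReal ((2 * (2 ^ i * n : ℕ) : ℝ) ^ (η * p) * ‖R i ω‖ ^ p) := by
    refine iSup₂_le fun k hk => ?_
    -- the index of the block that contains `k`
    set i := Nat.log 2 (k / n) with hi
    have hkn : k / n ≠ 0 := (Nat.div_pos hk hn).ne'
    have l1 : 2 ^ i * n ≤ k :=
      (Nat.le_div_iff_mul_le hn).1 (Nat.pow_log_le_self 2 hkn)
    have l2 : k ≤ 2 * (2 ^ i * n) := by
      have := (Nat.div_lt_iff_lt_mul hn).1 (Nat.lt_pow_succ_log_self (b := 2) (by norm_num) (k / n))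
      rw [← hi, pow_succ] at this
      linarith
    refine le_trans (ENNReal.ofReal_le_ofReal ?_) (ENNReal.le_tsum i)
    have l3 : (k : ℝ) ≤ 2 * (2 ^ i * n : ℕ) := by exact_mod_cast l2
    refine mul_le_mul (Real.rpow_le_rpow (by positivity) l3 (by positivity)) ?_ (by positivity)
      (by positivity)
    exact Real.rpow_le_rpow (norm_nonneg _) ((hRe i k l1 l2 ω).trans (le_abs_self _)) hp0.le
  have hint : ∫⁻ ω, ⨆ k : ℕ, ⨆ _ : n ≤ k, ENNReal.ofReal ((k : ℝ) ^ (η * p) * ‖e k ω‖ ^ p) ∂P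
      ≤ ENNReal.ofReal (A * (n : ℝ) ^ (-((ρ - η) * p))) := by
    refine (lintegral_mono hsup).trans ?_
    rw [lintegral_tsum fun i => (((hRL i).1.norm.aemeasurable.pow_const p).const_mul _).ennreal_ofReal]
    refine (ENNReal.tsum_le_tsum hterm).trans (le_of_eq ?_)
    rw [← ENNReal.ofReal_tsum_of_nonneg (fun i => by positivity)
      ((summable_geometric_of_lt_one hq0.le hq1).mul_left _), tsum_mul_left,
      tsum_geometric_of_lt_one hq0.le hq1]
    congr 1
    rw [hA]; ring
  refine (ENNReal.rpow_le_rpow hint (by positivity)).trans (le_of_eq ?_)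
  rw [ENNReal.ofReal_rpow_of_nonneg (by positivity) (by positivity),
    Real.mul_rpow hA0.le (by positivity), ← Real.rpow_mul hn0.le]
  congr 3
  field_simp

/-- Almost sure convergence with any rate below `ρ`. -/
theorem ae_tendsto (h : IsContractiveRecursion P 𝓕 p lam ρ c e d ζ) (hp : 2 ≤ p)
    (hρ : 0 < ρ) (hlam : ρ < lam) {δ : ℝ} (hδ : 0 < δ) :
    ∀ᵐ ω ∂P, Tendsto (fun n : ℕ => (n : ℝ) ^ (ρ - δ) * ‖e n ω‖) atTop (𝓝 0) := by
  have hp0 : 0 < p := by linarith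
  -- an exponent `η < ρ` that is larger than `ρ - δ`
  set η := max (ρ / 2) (ρ - δ / 2) with hηdef
  have hη : 0 < η := lt_max_of_lt_left (by linarith)
  have hηρ : η < ρ := max_lt (by linarith) (by linarith)
  have hηδ : ρ - δ - η < 0 := by have := le_max_right (ρ / 2) (ρ - δ / 2); linarith
  obtain ⟨κ, hκ, hb⟩ := h.exists_lintegral_iSup_le hp hρ hlam hη hηρ
  have hfin : ∫⁻ ω, ⨆ k : ℕ, ⨆ _ : 1 ≤ k, ENNReal.ofReal ((k : ℝ) ^ (η * p) * ‖e k ω‖ ^ p) ∂P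
      ≠ ∞ := by
    intro htop
    have := hb 1 le_rfl
    rw [htop, ENNReal.top_rpow_of_pos (by positivity)] at this
    exact ENNReal.ofReal_ne_top (top_le_iff.1 this)
  have hmeas : Measurable fun ω => ⨆ k : ℕ, ⨆ _ : 1 ≤ k,
      ENNReal.ofReal ((k : ℝ) ^ (η * p) * ‖e k ω‖ ^ p) :=
    Measurable.iSup fun k => Measurable.iSup fun _ =>
      (((measurable_norm.comp ((h.measurable k).mono (𝓕.le k) le_rfl)).pow_const p).const_mul
        _).ennreal_ofReal
  filter_upwards [ae_lt_top hmeas hfin] with ω hω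
  set T := (⨆ k : ℕ, ⨆ _ : 1 ≤ k, ENNReal.ofReal ((k : ℝ) ^ (η * p) * ‖e k ω‖ ^ p)).toReal
  have hT0 : 0 ≤ T := ENNReal.toReal_nonneg
  have hk (k : ℕ) (hk : 1 ≤ k) : (k : ℝ) ^ η * ‖e k ω‖ ≤ T ^ (1 / p) := by
    have h1 : ENNReal.ofReal ((k : ℝ) ^ (η * p) * ‖e k ω‖ ^ p) ≤ _ :=
      le_iSup₂ (f := fun (k : ℕ) (_ : 1 ≤ k) => ENNReal.ofReal ((k : ℝ) ^ (η * p) * ‖e k ω‖ ^ p)) k hk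
    have h2 := (ENNReal.ofReal_le_iff_le_toReal hω.ne).1 h1
    have h3 : ((k : ℝ) ^ η * ‖e k ω‖) ^ p ≤ T := by
      rwa [Real.mul_rpow (by positivity) (norm_nonneg _), ← Real.rpow_mul (by positivity)]
    have h4 := Real.rpow_le_rpow (by positivity) h3 (by positivity : 0 ≤ 1 / p)
    rwa [← Real.rpow_mul (by positivity), mul_one_div_cancel hp0.ne', Real.rpow_one] at h4
  have hlim : Tendsto (fun n : ℕ => T ^ (1 / p) * (n : ℝ) ^ (ρ - δ - η)) atTop (𝓝 0) := by
    have := (tendsto_rpow_neg_atTop (y := -(ρ - δ - η)) (by linarith)).comp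
      tendsto_natCast_atTop_atTop
    simpa using this.const_mul (T ^ (1 / p))
  refine squeeze_zero' (Eventually.of_forall fun n => by positivity) ?_ hlim
  filter_upwards [eventually_ge_atTop 1] with n hn
  have hn0 : (0 : ℝ) < n := by exact_mod_cast hn
  calc (n : ℝ) ^ (ρ - δ) * ‖e n ω‖ = (n : ℝ) ^ (ρ - δ - η) * ((n : ℝ) ^ η * ‖e n ω‖) := by
        rw [← mul_assoc, ← Real.rpow_add hn0]; ring_nf
    _ ≤ (n : ℝ) ^ (ρ - δ - η) * T ^ (1 / p) :=
        mul_le_mul_of_nonneg_left (hk n hn) (by positivity)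
    _ = _ := mul_comm _ _

end IsContractiveRecursion

end MLRM

/-! ### The multilevel estimator at a fixed parameter -/

namespace MLRM

section Levels

variable {E : Type*} {A : Params E}

/-- The weight of the maximal level `m` in the number of iterations, comparable to
`∑ k ≤ m, M ^ (k (1/2 - β))`. -/
noncomputable def levelWeight (A : Params E) (m : ℕ) : ℝ :=
  if A.β = 1 / 2 then (m : ℝ) else A.M ^ ((m : ℝ) * max (1 / 2 - A.β) 0)

lemma iterFactor_eq (A : Params E) (n : ℕ) (θ : E) :
    iterFactor A n θ = (A.Γ₁ θ / A.σ n) ^ 2 * levelWeight A (maxLevel A n θ) := by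
  unfold iterFactor levelWeight
  split_ifs <;> rfl

lemma one_le_maxLevel (A : Params E) (n : ℕ) (θ : E) : 1 ≤ maxLevel A n θ := le_max_left _ _

lemma one_le_levelWeight (hM : 1 < A.M) {m : ℕ} (hm : 1 ≤ m) : 1 ≤ levelWeight A m := by
  unfold levelWeight
  split_ifs
  · exact_mod_cast hm
  · exact Real.one_le_rpow hM.le (by positivity)

lemma exists_sum_rpow_le_levelWeight (hM : 1 < A.M) :
    ∃ c : ℝ, 0 < c ∧ ∀ m : ℕ,
      ∑ k ∈ Finset.range m, A.M ^ (((k : ℝ) + 1) * (1 / 2 - A.β)) ≤ c * levelWeight A m := by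
  have hM0 : 0 < A.M := by linarith
  have hpow (k : ℕ) : A.M ^ (((k : ℝ) + 1) * (1 / 2 - A.β))
      = A.M ^ (1 / 2 - A.β) * (A.M ^ (1 / 2 - A.β)) ^ k := by
    rw [← pow_succ', ← Real.rpow_natCast, ← Real.rpow_mul hM0.le]
    congr 1; push_cast; ring
  simp only [hpow, ← Finset.mul_sum]
  unfold levelWeight
  set q := A.M ^ (1 / 2 - A.β) with hq
  have hq0 : 0 < q := Real.rpow_pos_of_pos hM0 _
  rcases lt_trichotomy A.β (1 / 2) with h | h | h
  · have hq1 : 1 < q := Real.one_lt_rpow hM (by linarith)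
    have hd : 0 < q - 1 := by linarith
    refine ⟨q / (q - 1), by positivity, fun m => ?_⟩
    rw [if_neg h.ne, max_eq_left (by linarith), mul_comm (m : ℝ), Real.rpow_mul hM0.le,
      Real.rpow_natCast, ← hq, geom_sum_eq hq1.ne', div_mul_eq_mul_div, mul_div_assoc']
    gcongr
    linarith
  · refine ⟨q, hq0, fun m => ?_⟩
    have : q = 1 := by rw [hq, h]; norm_num
    rw [if_pos h, this]
    simp
  · have hq1 : q < 1 := Real.rpow_lt_one_of_one_lt_of_neg hM (by linarith)
    have hd : 0 < 1 - q := by linarith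
    refine ⟨q * (1 - q)⁻¹, by positivity, fun m => ?_⟩
    rw [if_neg h.ne', max_eq_right (by linarith), mul_zero, Real.rpow_zero, mul_one]
    refine mul_le_mul_of_nonneg_left ?_ hq0.le
    rw [← tsum_geometric_of_lt_one hq0.le hq1]
    exact (summable_geometric_of_lt_one hq0.le hq1).sum_le_tsum _ fun _ _ => by positivity

/-- At the maximal level the bias is at most `ε n`. -/
lemma mul_rpow_maxLevel_le (hM : 1 < A.M) (hα : 0 < A.α) {n : ℕ} (hε : 0 < A.ε n) {θ : E}
    (hΓ : 0 < A.Γ₂ θ) : A.Γ₂ θ * A.M ^ (-((maxLevel A n θ : ℝ) * A.α)) ≤ A.ε n := by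
  have hM0 : 0 < A.M := by linarith
  have h1 : 1 / A.α * Real.logb A.M (A.Γ₂ θ / A.ε n) ≤ maxLevel A n θ :=
    (Nat.le_ceil _).trans (by exact_mod_cast le_max_right _ _)
  have h2 : Real.logb A.M (A.Γ₂ θ / A.ε n) ≤ (maxLevel A n θ : ℝ) * A.α := by
    rw [one_div, inv_mul_eq_div, div_le_iff₀ hα] at h1
    exact h1
  rw [Real.logb_le_iff_le_rpow hM (by positivity), div_le_iff₀ hε] at h2
  rw [Real.rpow_neg hM0.le, ← div_eq_mul_inv, div_le_iff₀ (Real.rpow_pos_of_pos hM0 _)]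
  linarith

lemma iterFactor_pos (hM : 1 < A.M) {n : ℕ} (hσ : 0 < A.σ n) {θ : E} (hΓ : 0 < A.Γ₁ θ) :
    0 < iterFactor A n θ := by
  rw [iterFactor_eq]
  have := one_le_levelWeight hM (one_le_maxLevel A n θ)
  positivity

lemma le_numIter (A : Params E) (n k : ℕ) (θ : E) :
    iterFactor A n θ * A.M ^ (-((k : ℝ) * (A.β + 1 / 2))) ≤ numIter A n k θ :=
  Nat.le_ceil _

lemma numIter_pos (hM : 1 < A.M) {n : ℕ} (hσ : 0 < A.σ n) {θ : E} (hΓ : 0 < A.Γ₁ θ) (k : ℕ) :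
    0 < numIter A n k θ :=
  Nat.ceil_pos.2 (mul_pos (iterFactor_pos hM hσ hΓ) (Real.rpow_pos_of_pos (by linarith) _))

variable [MeasurableSpace E]

lemma measurable_maxLevel (h : Measurable A.Γ₂) (n : ℕ) : Measurable (maxLevel A n) := by
  unfold maxLevel Real.logb
  exact measurable_const.max
    (((Real.measurable_log.comp (h.div_const _)).div_const _).const_mul _).nat_ceil

lemma measurable_numIter (h₁ : Measurable A.Γ₁) (h₂ : Measurable A.Γ₂) (n k : ℕ) :
    Measurable (numIter A n k) := by
  have hm : Measurable fun θ => levelWeight A (maxLevel A n θ) :=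
    (measurable_of_countable (levelWeight A)).comp (measurable_maxLevel h₂ n)
  unfold numIter
  simp only [iterFactor_eq]
  exact ((((h₁.div_const _).pow_const 2).mul hm).mul_const _).nat_ceil

end Levels

lemma sum_Icc_one_eq_sum_range {G : Type*} [AddCommMonoid G] (f : ℕ → G) (m : ℕ) :
    ∑ k ∈ Finset.Icc 1 m, f k = ∑ k ∈ Finset.range m, f (k + 1) := by
  induction m with
  | zero => simp
  | succ m ih => rw [Finset.sum_Icc_succ_top (by omega), ih, Finset.sum_range_succ]

section LevelSum

variable {E : Type*} [NormedAddCommGroup E] [InnerProductSpace ℝ E] {S : Type*}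

/-- The multilevel estimator as a function of the parameter `θ` and of the samples: `v (k, l)` is the
`(l + 1)`-st sample for level `k + 1`. -/
noncomputable def levelSum (A : Params E) (Fk : ℕ → E × S → E) (n : ℕ) (θ : E) (v : ℕ × ℕ → S) : E :=
  ∑ k ∈ Finset.range (maxLevel A n θ), (1 / (numIter A n (k + 1) θ : ℝ)) •
    ∑ l ∈ Finset.range (numIter A n (k + 1) θ), (Fk (k + 1) (θ, v (k, l)) - Fk k (θ, v (k, l)))

lemma estimator_eq_levelSum {Ω : Type*} (A : Params E) (Fk : ℕ → E × S → E)
    (V : ℕ → ℕ → ℕ → Ω → S) (n : ℕ) (θ : E) (ω : Ω) :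
    estimator A Fk V n θ ω = levelSum A Fk n θ fun i => V n (i.1 + 1) (i.2 + 1) ω := by
  unfold estimator levelSum
  simp only [sum_Icc_one_eq_sum_range, Nat.add_sub_cancel]

variable {Ω : Type*} [MeasurableSpace Ω] {P : Measure Ω} {U : Ω → S}

/-- The expectation of the multilevel estimator at a fixed `θ`; the differences of the levels
telescope to the expectation at the maximal level. -/
noncomputable def levelMean (P : Measure Ω) (U : Ω → S) (A : Params E) (Fk : ℕ → E × S → E) (n : ℕ) (θ : E) : E :=
  ∫ ω, Fk (maxLevel A n θ) (θ, U ω) ∂P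

/-- The centred multilevel estimator is a weighted sum of independent centred variables. -/
lemma levelSum_sub_levelMean {A : Params E} {Fk : ℕ → E × S → E} (hFk0 : ∀ x, Fk 0 x = 0) {θ : E}
    (hint : ∀ k, Integrable (fun ω => Fk k (θ, U ω)) P) {n : ℕ}
    (hN : ∀ k, 0 < numIter A n k θ) (v : ℕ × ℕ → S) :
    levelSum A Fk n θ v - levelMean P U A Fk n θ
      = ∑ i ∈ (Finset.range (maxLevel A n θ)).sigma fun k => Finset.range (numIter A n (k + 1) θ),
        (1 / (numIter A n (i.1 + 1) θ : ℝ)) •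
          ((Fk (i.1 + 1) (θ, v (i.1, i.2)) - Fk i.1 (θ, v (i.1, i.2)))
            - ∫ ω, (Fk (i.1 + 1) (θ, U ω) - Fk i.1 (θ, U ω)) ∂P) := by
  rw [Finset.sum_sigma]
  have htel : levelMean P U A Fk n θ = ∑ k ∈ Finset.range (maxLevel A n θ),
      ∫ ω, (Fk (k + 1) (θ, U ω) - Fk k (θ, U ω)) ∂P := by
    have e (k : ℕ) : ∫ ω, (Fk (k + 1) (θ, U ω) - Fk k (θ, U ω)) ∂P
        = ∫ ω, Fk (k + 1) (θ, U ω) ∂P - ∫ ω, Fk k (θ, U ω) ∂P := integral_sub (hint _) (hint _)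
    simp only [e]
    rw [Finset.sum_range_sub (fun k => ∫ ω, Fk k (θ, U ω) ∂P)]
    simp [levelMean, hFk0]
  rw [htel, levelSum, ← Finset.sum_sub_distrib]
  refine Finset.sum_congr rfl fun k _ => ?_
  dsimp only
  rw [← Finset.smul_sum, Finset.sum_sub_distrib _ (fun _ => ∫ ω, _ ∂P), smul_sub, Finset.sum_const, Finset.card_range,
    ← Nat.cast_smul_eq_nsmul ℝ, smul_smul]
  have : (numIter A n (k + 1) θ : ℝ) ≠ 0 := by exact_mod_cast (hN (k + 1)).ne'
  rw [one_div, inv_mul_cancel₀ this, one_smul]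

variable [MeasurableSpace E] [BorelSpace E] [FiniteDimensional ℝ E] [MeasurableSpace S]

lemma measurable_sum_range_comp {X : Type*} [MeasurableSpace X] {N : X → ℕ} (hN : Measurable N)
    {f : ℕ → X → E} (hf : ∀ k, Measurable (f k)) :
    Measurable fun x => ∑ k ∈ Finset.range (N x), f k x := by
  have h : Measurable fun y : ℕ × X => ∑ k ∈ Finset.range y.1, f k y.2 :=
    measurable_from_prod_countable_right fun n => Finset.measurable_sum (Finset.range n) fun k _ => hf k
  exact h.comp (hN.prodMk measurable_id)

lemma measurable_levelSum {A : Params E} {Fk : ℕ → E × S → E} (hF : ∀ k, Measurable (Fk k))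
    (h₁ : Measurable A.Γ₁) (h₂ : Measurable A.Γ₂) (n : ℕ) :
    Measurable fun x : E × (ℕ × ℕ → S) => levelSum A Fk n x.1 x.2 := by
  unfold levelSum
  refine measurable_sum_range_comp ((measurable_maxLevel h₂ n).comp measurable_fst) fun k => ?_
  have hN : Measurable fun x : E × (ℕ × ℕ → S) => numIter A n (k + 1) x.1 :=
    (measurable_numIter h₁ h₂ n (k + 1)).comp measurable_fst
  refine Measurable.smul (((measurable_of_countable fun N : ℕ => 1 / (N : ℝ)).comp hN))
    (measurable_sum_range_comp hN fun l => ?_)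
  have hv : Measurable fun x : E × (ℕ × ℕ → S) => (x.1, x.2 (k, l)) :=
    measurable_fst.prodMk ((measurable_pi_apply (k, l)).comp measurable_snd)
  exact ((hF (k + 1)).comp hv).sub ((hF k).comp hv)

lemma measurable_levelMean [SFinite P] {A : Params E} {Fk : ℕ → E × S → E}
    (hF : ∀ k, Measurable (Fk k)) (hU : Measurable U) (h₂ : Measurable A.Γ₂) (n : ℕ) :
    Measurable (levelMean P U A Fk n) := by
  have h : Measurable fun y : ℕ × E => ∫ ω, Fk y.1 (y.2, U ω) ∂P :=
    measurable_from_prod_countable_right fun k => by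
      have hm : Measurable fun x : E × Ω => Fk k (x.1, U x.2) :=
        (hF k).comp (measurable_fst.prodMk (hU.comp measurable_snd))
      exact hm.stronglyMeasurable.integral_prod_right'.measurable
  exact h.comp ((measurable_maxLevel h₂ n).prodMk measurable_id)

/-- Uniformly in `θ`, the noise of the multilevel estimator has `L^p` norm of order `σ n`. -/
theorem exists_lpNorm_levelSum_le [IsProbabilityMeasure P] {p : ℝ} (hp : 2 ≤ p)
    {F : E × S → E} {Fk : ℕ → E × S → E} (hFk0 : ∀ x, Fk 0 x = 0) (hF : ∀ k, Measurable (Fk k))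
    (hint : ∀ k θ, Integrable (fun ω => Fk k (θ, U ω)) P) (hU : Measurable U)
    {C : ℕ → ℝ} {A : Params E} (hC1 : AssumptionC1 P U p F Fk C A) :
    ∃ c : ℝ, 0 < c ∧ ∀ (W : ℕ × ℕ → Ω → S), (∀ i, Measurable (W i)) →
      (∀ i, IdentDistrib (W i) U P P) → iIndepFun W P → ∀ (n : ℕ) (θ : E), 0 < A.σ n →
      MemLp (fun ω => levelSum A Fk n θ (fun i => W i ω) - levelMean P U A Fk n θ)
        (ENNReal.ofReal p) P ∧
      lpNorm (fun ω => levelSum A Fk n θ (fun i => W i ω) - levelMean P U A Fk n θ)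
        (ENNReal.ofReal p) P ≤ c * A.σ n ∧
      ∫ ω, (levelSum A Fk n θ (fun i => W i ω) - levelMean P U A Fk n θ) ∂P = 0 := by
  obtain ⟨C₀, hC₀, hMZ⟩ := exists_lpNorm_sum_sq_le_of_iIndepFun (E := E) hp P
  have hM := hC1.one_lt_M
  have hM0 : 0 < A.M := by linarith
  obtain ⟨c₀, hc₀, hgeo⟩ := exists_sum_rpow_le_levelWeight (A := A) hM
  refine ⟨C₀ * (c₀ + 1), by positivity, fun W hW hWU hWi n θ hσ => ?_⟩
  have hp1 : 1 ≤ ENNReal.ofReal p := by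
    rw [← ENNReal.ofReal_one]; exact ENNReal.ofReal_le_ofReal (by linarith)
  have hΓ := hC1.Γ₁_pos θ
  have hN := numIter_pos hM hσ hΓ
  have hFθ (k : ℕ) : Measurable fun s => Fk k (θ, s) := (hF k).comp measurable_prodMk_left
  set g : ℕ → S → E := fun k s => (Fk (k + 1) (θ, s) - Fk k (θ, s))
    - ∫ ω, (Fk (k + 1) (θ, U ω) - Fk k (θ, U ω)) ∂P with hg
  have hgm (k : ℕ) : Measurable (g k) := ((hFθ (k + 1)).sub (hFθ k)).sub_const _
  have hgU (k : ℕ) : eLpNorm (fun ω => g k (U ω)) (ENNReal.ofReal p) P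
      ≤ ENNReal.ofReal (A.Γ₁ θ * A.M ^ (-(((k : ℝ) + 1) * A.β))) := by
    have := hC1.moment (k + 1) (by omega) θ
    simpa using this
  have hgid (i : ℕ × ℕ) : IdentDistrib (fun ω => g i.1 (W i ω)) (fun ω => g i.1 (U ω)) P P :=
    (hWU i).comp (hgm i.1)
  have hgUL (k : ℕ) : MemLp (fun ω => g k (U ω)) (ENNReal.ofReal p) P :=
    ⟨((hgm k).comp hU).aestronglyMeasurable, (hgU k).trans_lt ENNReal.ofReal_lt_top⟩
  have hgL (i : ℕ × ℕ) : MemLp (fun ω => g i.1 (W i ω)) (ENNReal.ofReal p) P :=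
    (hgid i).memLp_iff.2 (hgUL i.1)
  have hgle (i : ℕ × ℕ) : lpNorm (fun ω => g i.1 (W i ω)) (ENNReal.ofReal p) P
      ≤ A.Γ₁ θ * A.M ^ (-(((i.1 : ℝ) + 1) * A.β)) := by
    rw [← toReal_eLpNorm (hgL i).1, (hgid i).eLpNorm_eq]
    exact ENNReal.toReal_le_of_le_ofReal (by positivity) (hgU i.1)
  have hg0 (i : ℕ × ℕ) : ∫ ω, g i.1 (W i ω) ∂P = 0 := by
    rw [(hgid i).integral_eq]
    exact (integral_sub ((hint (i.1 + 1) θ).sub (hint i.1 θ)) (integrable_const _)).trans (by simp)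
  set X : ℕ × ℕ → Ω → E := fun i ω => (1 / (numIter A n (i.1 + 1) θ : ℝ)) • g i.1 (W i ω) with hX
  have hXi : iIndepFun X P :=
    hWi.comp (fun i s => (1 / (numIter A n (i.1 + 1) θ : ℝ)) • g i.1 s)
      fun i => (hgm i.1).const_smul _
  have hXm (i) : Measurable (X i) := ((hgm i.1).comp (hW i)).const_smul _
  have hXL (i) : MemLp (X i) (ENNReal.ofReal p) P := (hgL i).const_smul _
  have hX0 (i) : ∫ ω, X i ω ∂P = 0 := by
    simp only [hX]
    rw [integral_smul, hg0, smul_zero]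
  set s := (Finset.range (maxLevel A n θ)).sigma fun k => Finset.range (numIter A n (k + 1) θ)
    with hs
  set emb : (_ : ℕ) × ℕ ↪ ℕ × ℕ := (Equiv.sigmaEquivProd ℕ ℕ).toEmbedding with hemb
  have hrepr : (fun ω => levelSum A Fk n θ (fun i => W i ω) - levelMean P U A Fk n θ)
      = fun ω => ∑ i ∈ s.map emb, X i ω := by
    ext ω
    rw [levelSum_sub_levelMean hFk0 (fun k => hint k θ) hN, Finset.sum_map]
    rfl
  rw [hrepr]
  refine ⟨memLp_finsetSum _ fun i _ => hXL i, ?_, ?_⟩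
  · have h1 := hMZ X hXi hXm hXL hX0 (s.map emb)
    have h2 : ∑ i ∈ s.map emb, lpNorm (X i) (ENNReal.ofReal p) P ^ 2 ≤ c₀ * A.σ n ^ 2 := by
      rw [Finset.sum_map, hs, Finset.sum_sigma]
      have hκ := iterFactor_pos hM hσ hΓ (θ := θ)
      have hlev : ∀ k ∈ Finset.range (maxLevel A n θ),
          ∑ l ∈ Finset.range (numIter A n (k + 1) θ),
            lpNorm (X (emb ⟨k, l⟩)) (ENNReal.ofReal p) P ^ 2
          ≤ A.Γ₁ θ ^ 2 / iterFactor A n θ * A.M ^ (((k : ℝ) + 1) * (1 / 2 - A.β)) := by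
        intro k _
        set N := numIter A n (k + 1) θ with hNdef
        have hN0 : (0 : ℝ) < N := by exact_mod_cast hN (k + 1)
        have hb (l : ℕ) : lpNorm (X (emb ⟨k, l⟩)) (ENNReal.ofReal p) P ^ 2
            ≤ (1 / (N : ℝ) * (A.Γ₁ θ * A.M ^ (-(((k : ℝ) + 1) * A.β)))) ^ 2 := by
          refine pow_le_pow_left₀ lpNorm_nonneg ?_ 2
          have : X (emb ⟨k, l⟩) = (1 / (N : ℝ)) • fun ω => g k (W (k, l) ω) := rfl
          rw [this, lpNorm_const_smul]
          have hnn : ‖(1 / (N : ℝ))‖₊ = 1 / (N : ℝ) := by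
            rw [coe_nnnorm, Real.norm_of_nonneg (by positivity)]
          rw [hnn]
          exact mul_le_mul_of_nonneg_left (hgle (k, l)) (by positivity)
        refine (Finset.sum_le_sum fun l _ => hb l).trans ?_
        rw [Finset.sum_const, Finset.card_range, nsmul_eq_mul]
        have hNl : iterFactor A n θ * A.M ^ (-(((k : ℝ) + 1) * (A.β + 1 / 2))) ≤ N := by
          have := le_numIter A n (k + 1) θ
          push_cast at this
          exact this
        have hlow : 0 < iterFactor A n θ * A.M ^ (-(((k : ℝ) + 1) * (A.β + 1 / 2))) := by positivity
        calc (N : ℝ) * (1 / (N : ℝ) * (A.Γ₁ θ * A.M ^ (-(((k : ℝ) + 1) * A.β)))) ^ 2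
            = (A.Γ₁ θ * A.M ^ (-(((k : ℝ) + 1) * A.β))) ^ 2 / N := by field_simp
          _ ≤ (A.Γ₁ θ * A.M ^ (-(((k : ℝ) + 1) * A.β))) ^ 2
              / (iterFactor A n θ * A.M ^ (-(((k : ℝ) + 1) * (A.β + 1 / 2)))) := by gcongr
          _ = A.Γ₁ θ ^ 2 / iterFactor A n θ * ((A.M ^ (-(((k : ℝ) + 1) * A.β))) ^ 2
              / A.M ^ (-(((k : ℝ) + 1) * (A.β + 1 / 2)))) := by
                rw [mul_pow, mul_div_mul_comm]
          _ = _ := by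
            rw [← Real.rpow_natCast (A.M ^ (-(((k : ℝ) + 1) * A.β))), ← Real.rpow_mul hM0.le,
              ← Real.rpow_sub hM0]
            congr 2; push_cast; ring
      refine (Finset.sum_le_sum hlev).trans ?_
      rw [← Finset.mul_sum]
      refine (mul_le_mul_of_nonneg_left (hgeo _) (by positivity)).trans (le_of_eq ?_)
      have hw := one_le_levelWeight hM (one_le_maxLevel A n θ)
      have hw0 : levelWeight A (maxLevel A n θ) ≠ 0 := by positivity
      rw [iterFactor_eq]
      field_simp
    refine (sq_le_sq₀ lpNorm_nonneg (by positivity)).1 (h1.trans ?_)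
    refine (mul_le_mul_of_nonneg_left h2 (by linarith)).trans ?_
    have e1 : C₀ ≤ C₀ ^ 2 := by nlinarith
    have e2 : c₀ ≤ (c₀ + 1) ^ 2 := by nlinarith
    calc C₀ * (c₀ * A.σ n ^ 2) ≤ C₀ ^ 2 * ((c₀ + 1) ^ 2 * A.σ n ^ 2) := by gcongr
      _ = _ := by ring
  · rw [integral_finsetSum _ fun i _ => (hXL i).integrable hp1]
    exact Finset.sum_eq_zero fun i _ => hX0 i

end LevelSum

end MLRM

/-! ### Independence of the past, contraction of the drift, and bias -/

namespace MLRM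

section Past

variable {Ω S : Type*} [mΩ : MeasurableSpace Ω] [MeasurableSpace S] {P : Measure Ω}

/-- The filtration of the samples: `n` reveals all `W (j, k, l)` with `j < n`. -/
def pastFiltration (W : ℕ × ℕ × ℕ → Ω → S) (hW : ∀ i, Measurable (W i)) : Filtration ℕ mΩ where
  seq n := ⨆ i ∈ {i : ℕ × ℕ × ℕ | i.1 < n}, MeasurableSpace.comap (W i) inferInstance
  mono' _ _ hmn := biSup_mono fun _ hi => lt_of_lt_of_le hi hmn
  le' _ := iSup₂_le fun i _ => (hW i).comap_le

variable {W : ℕ × ℕ × ℕ → Ω → S}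

lemma measurable_block (hW : ∀ i, Measurable (W i)) (n : ℕ) :
    Measurable[pastFiltration W hW (n + 1)] fun ω (i : ℕ × ℕ) => W (n, i) ω := by
  refine @measurable_pi_lambda _ _ _ (_) _ _ fun i => Measurable.mono (comap_measurable _) ?_ le_rfl
  exact le_iSup₂_of_le (f := fun (i : ℕ × ℕ × ℕ) (_ : i ∈ {i : ℕ × ℕ × ℕ | i.1 < n + 1}) =>
    MeasurableSpace.comap (W i) inferInstance) (n, i) (Nat.lt_succ_self n) le_rfl

/-- The samples used in step `n` are independent of the past. -/
lemma indepFun_id_block (hW : ∀ i, Measurable (W i)) (hind : iIndepFun W P) (n : ℕ) :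
    @IndepFun Ω Ω (ℕ × ℕ → S) mΩ (pastFiltration W hW n) _ id
      (fun ω (i : ℕ × ℕ) => W (n, i) ω) P := by
  have hdisj : Disjoint {i : ℕ × ℕ × ℕ | i.1 < n} {i : ℕ × ℕ × ℕ | i.1 = n} :=
    Set.disjoint_left.2 fun i hi hi' => (ne_of_lt hi) hi'
  have h := indep_iSup_of_disjoint (fun i => (hW i).comap_le) hind.iIndep hdisj
  rw [@IndepFun_iff_Indep Ω Ω _ mΩ (pastFiltration W hW n) _ id _ P, MeasurableSpace.comap_id]
  refine indep_of_indep_of_le_right h ?_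
  refine Measurable.comap_le ?_
  refine @measurable_pi_lambda _ _ _ (_) _ _ fun i => Measurable.mono (comap_measurable _) ?_ le_rfl
  exact le_iSup₂_of_le (f := fun (i : ℕ × ℕ × ℕ) (_ : i ∈ {i : ℕ × ℕ × ℕ | i.1 = n}) =>
    MeasurableSpace.comap (W i) inferInstance) (n, i) rfl le_rfl

lemma eLpNorm_comp_le_of_indepFun {E : Type*} [NormedAddCommGroup E] [MeasurableSpace E]
    [BorelSpace E] [IsProbabilityMeasure P] {T : Type*}
    {mT : MeasurableSpace T} {H : Ω → T} {B : Ω → S} (hH : Measurable H)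
    (hB : Measurable B) (hind : IndepFun H B P) {G : T × S → E} (hG : Measurable G) {p : ℝ}
    (hp : 0 < p) {c : ℝ≥0∞} (h : ∀ t, eLpNorm (fun ω => G (t, B ω)) (ENNReal.ofReal p) P ≤ c) :
    eLpNorm (fun ω => G (H ω, B ω)) (ENNReal.ofReal p) P ≤ c := by
  have hprod := (indepFun_iff_map_prod_eq_prod_map_map hH.aemeasurable hB.aemeasurable).1 hind
  have : IsProbabilityMeasure (P.map H) := Measure.isProbabilityMeasure_map hH.aemeasurable
  have : IsProbabilityMeasure (P.map B) := Measure.isProbabilityMeasure_map hB.aemeasurable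
  have hp' : ENNReal.ofReal p ≠ 0 := by simpa using hp
  simp only [eLpNorm_eq_lintegral_rpow_enorm_toReal hp' ENNReal.ofReal_ne_top,
    ENNReal.toReal_ofReal hp.le, one_div, ENNReal.rpow_inv_le_iff hp] at h ⊢
  have hm : Measurable fun x : T × S => ‖G x‖ₑ ^ p := hG.enorm.pow_const p
  have e : ∫⁻ ω, ‖G (H ω, B ω)‖ₑ ^ p ∂P = ∫⁻ x, ‖G x‖ₑ ^ p ∂((P.map H).prod (P.map B)) := by
    rw [← hprod, lintegral_map hm (hH.prodMk hB)]
  rw [e, lintegral_prod _ hm.aemeasurable]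
  have h' (t : T) : ∫⁻ v, ‖G (t, v)‖ₑ ^ p ∂(P.map B) ≤ c ^ p := by
    rw [lintegral_map (f := fun v => ‖G (t, v)‖ₑ ^ p) (hm.comp measurable_prodMk_left) hB]
    exact h t
  refine (lintegral_mono h').trans ?_
  simp

end Past

section Drift

variable {E : Type*} [NormedAddCommGroup E] [InnerProductSpace ℝ E]

lemma AssumptionA1.exists_norm_le {f : E → E} {θstar : E} {L : ℝ} (h : AssumptionA1 f θstar L) :
    ∃ c : ℝ, 0 < c ∧ ∀ θ, ‖f θ‖ ≤ c * ‖θ - θstar‖ := by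
  obtain ⟨L', hL', hg⟩ := h.growth
  refine ⟨1 / L', by positivity, fun θ => ?_⟩
  have h1 := hg θ
  have h2 := (abs_le.1 (abs_real_inner_le_norm (θ - θstar) (f θ))).1
  rw [div_mul_eq_mul_div, one_mul, le_div_iff₀ hL']
  rcases eq_or_lt_of_le (norm_nonneg (f θ)) with h0 | h0
  · rw [← h0]; simp
  · have : ‖f θ‖ * L' * ‖f θ‖ ≤ ‖θ - θstar‖ * ‖f θ‖ := by nlinarith
    exact le_of_mul_le_mul_right this h0

/-- A drift step with small step-size contracts; the growth condition absorbs the quadratic term. -/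
lemma AssumptionA1.exists_contraction {f : E → E} {θstar : E} {L : ℝ} (h : AssumptionA1 f θstar L)
    {γ₀ lam : ℝ} (hγ₀ : 0 < γ₀) (hlam : lam < γ₀ * L) :
    ∃ n₀ : ℕ, ∀ n : ℕ, n₀ ≤ n → ∀ θ,
      ‖θ - θstar + (γ₀ / (n + 1)) • f θ‖ ≤ (1 - lam / (n + 1)) * ‖θ - θstar‖ := by
  obtain ⟨L', hL', hg⟩ := h.growth
  have hL := h.L_pos
  have hd : 0 < γ₀ * L - lam := by linarith
  obtain ⟨n₀, hn₀⟩ := exists_nat_ge (max (max lam (γ₀ / L')) (γ₀ ^ 2 * L / (L' * (γ₀ * L - lam))))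
  refine ⟨n₀, fun n hn θ => ?_⟩
  have hnm : (n₀ : ℝ) ≤ n := by exact_mod_cast hn
  have h1 := (le_max_left _ _).trans ((le_max_left _ _).trans hn₀)
  have h2 := (le_max_right _ _).trans ((le_max_left _ _).trans hn₀)
  have h3 := (le_max_right _ _).trans hn₀
  have hm : (0 : ℝ) < n + 1 := by positivity
  set m : ℝ := n + 1 with hmdef
  set x := θ - θstar with hx
  have hlm : lam / m ≤ 1 := by rw [div_le_one hm]; linarith
  refine (sq_le_sq₀ (norm_nonneg _) (mul_nonneg (by linarith) (norm_nonneg _))).1 ?_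
  have hgm : γ₀ / m / L' ≤ 1 := by
    rw [div_div, div_le_one (by positivity)]
    rw [div_le_iff₀ hL'] at h2
    nlinarith
  set g := γ₀ / m with hgdef
  have hg0 : 0 < g := by positivity
  have hc := h.contraction θ
  have hq := hg θ
  rw [norm_add_sq_real, real_inner_smul_right, norm_smul, Real.norm_of_nonneg hg0.le, mul_pow]
  have e1 : g ^ 2 * ‖f θ‖ ^ 2 ≤ -(g ^ 2 / L') * inner ℝ x (f θ) := by
    have : ‖f θ‖ ^ 2 ≤ -inner ℝ x (f θ) / L' := by rw [le_div_iff₀ hL']; linarith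
    calc g ^ 2 * ‖f θ‖ ^ 2 ≤ g ^ 2 * (-inner ℝ x (f θ) / L') := by gcongr
      _ = _ := by ring
  have e2 : g * (2 - g / L') * inner ℝ x (f θ) ≤ g * (2 - g / L') * (-L * ‖x‖ ^ 2) :=
    mul_le_mul_of_nonneg_left hc (mul_nonneg hg0.le (by linarith))
  have e3 : 1 - g * (2 - g / L') * L ≤ (1 - lam / m) ^ 2 := by
    have k1 : g * (g / L') * L ≤ (γ₀ * L - lam) / m := by
      rw [div_le_iff₀ (by positivity)] at h3
      rw [hgdef, le_div_iff₀ hm]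
      have : γ₀ / m * (γ₀ / m / L') * L * m = γ₀ ^ 2 * L / (L' * m) := by field_simp
      rw [this, div_le_iff₀ (by positivity)]
      have h4 : (n₀ : ℝ) ≤ m := by linarith
      have := mul_le_mul_of_nonneg_right h4 (by positivity : 0 ≤ L' * (γ₀ * L - lam))
      linarith
    have k2 : (γ₀ * L - lam) / m = g * L - lam / m := by rw [hgdef]; ring
    have k3 : 0 ≤ (γ₀ * L - lam) / m := by positivity
    nlinarith [sq_nonneg (lam / m)]
  have e4 := mul_le_mul_of_nonneg_right e3 (sq_nonneg ‖x‖)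
  have e5 : -(g ^ 2 / L') * inner ℝ x (f θ) + 2 * (g * inner ℝ x (f θ))
    = g * (2 - g / L') * inner ℝ x (f θ) := by ring
  rw [mul_pow]
  linarith

end Drift

section Bias

variable {E : Type*} [NormedAddCommGroup E] [InnerProductSpace ℝ E] [MeasurableSpace E]
  {Ω S : Type*} [MeasurableSpace Ω] {P : Measure Ω} {U : Ω → S}

lemma norm_levelMean_sub_meanFun_le {p : ℝ} {F : E × S → E} {Fk : ℕ → E × S → E} {C : ℕ → ℝ}
    {A : Params E} (hC1 : AssumptionC1 P U p F Fk C A)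
    (hFint : ∀ θ, Integrable (fun ω => F (θ, U ω)) P)
    (hFkint : ∀ k θ, Integrable (fun ω => Fk k (θ, U ω)) P) {n : ℕ} (hε : 0 < A.ε n) (θ : E) :
    ‖levelMean P U A Fk n θ - meanFun P U F θ‖ ≤ A.ε n := by
  rw [levelMean, meanFun, ← integral_sub (hFkint _ θ) (hFint θ)]
  exact (hC1.bias _ (one_le_maxLevel A n θ) θ).trans
    (mul_rpow_maxLevel_le hC1.one_lt_M hC1.α_pos hε (hC1.Γ₂_pos θ))

end Bias

end MLRM

/-! ### The scheme as a contractive recursion -/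

namespace MLRM

variable {E : Type*} [NormedAddCommGroup E] [InnerProductSpace ℝ E] [FiniteDimensional ℝ E]
  [MeasurableSpace E] [BorelSpace E]
variable {Ω : Type*} [mΩ : MeasurableSpace Ω] {P : Measure Ω} [IsProbabilityMeasure P]
  {S : Type*} [MeasurableSpace S] {U : Ω → S}

/-- The centred multilevel estimators, evaluated along an adapted process and multiplied by
deterministic step-sizes, are martingale differences. -/
lemma isMartingaleDiff_levelSum {p : ℝ} (hp : 2 ≤ p) {Fk : ℕ → E × S → E}
    (hF : ∀ k, Measurable (Fk k)) (hU : Measurable U) {A : Params E} (h₁ : Measurable A.Γ₁)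
    (h₂ : Measurable A.Γ₂) {W : ℕ × ℕ × ℕ → Ω → S} (hW : ∀ i, Measurable (W i))
    (hWi : iIndepFun W P) {c : ℝ} (hc : 0 ≤ c)
    (hmom : ∀ (n : ℕ) (θ : E),
      MemLp (fun ω => levelSum A Fk (n + 1) θ (fun i => W (n, i) ω)
        - levelMean P U A Fk (n + 1) θ) (ENNReal.ofReal p) P ∧
      lpNorm (fun ω => levelSum A Fk (n + 1) θ (fun i => W (n, i) ω)
        - levelMean P U A Fk (n + 1) θ) (ENNReal.ofReal p) P ≤ c * A.σ (n + 1) ∧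
      ∫ ω, (levelSum A Fk (n + 1) θ (fun i => W (n, i) ω) - levelMean P U A Fk (n + 1) θ) ∂P = 0)
    (hσ : ∀ n, 0 < A.σ (n + 1)) (γ : ℕ → ℝ) (hγ : ∀ n, 0 ≤ γ n)
    {Θ : ℕ → Ω → E} (hΘ : ∀ n, Measurable[pastFiltration W hW n] (Θ n)) :
    IsMartingaleDiff P (pastFiltration W hW) p (fun n ω => γ n •
      (levelSum A Fk (n + 1) (Θ n ω) (fun i => W (n, i) ω)
        - levelMean P U A Fk (n + 1) (Θ n ω))) ∧
    ∀ n, lpNorm (fun ω => γ n • (levelSum A Fk (n + 1) (Θ n ω) (fun i => W (n, i) ω)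
        - levelMean P U A Fk (n + 1) (Θ n ω))) (ENNReal.ofReal p) P
      ≤ γ n * (c * A.σ (n + 1)) := by
  have hp0 : 0 < p := by linarith
  have hp1 : 1 ≤ ENNReal.ofReal p := by
    rw [← ENNReal.ofReal_one]; exact ENNReal.ofReal_le_ofReal (by linarith)
  set 𝓕 := pastFiltration W hW with h𝓕
  set G : ℕ → E × (ℕ × ℕ → S) → E := fun n x =>
    levelSum A Fk (n + 1) x.1 x.2 - levelMean P U A Fk (n + 1) x.1 with hG
  have hGm (n : ℕ) : Measurable (G n) := (measurable_levelSum hF h₁ h₂ (n + 1)).sub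
    ((measurable_levelMean hF hU h₂ (n + 1)).comp measurable_fst)
  have hB (n : ℕ) : Measurable fun ω (i : ℕ × ℕ) => W (n, i) ω :=
    measurable_pi_lambda _ fun i => hW (n, i)
  have hΘ' (n : ℕ) : Measurable (Θ n) := (hΘ n).mono (𝓕.le n) le_rfl
  have hΘB (n : ℕ) : IndepFun (Θ n) (fun ω (i : ℕ × ℕ) => W (n, i) ω) P :=
    IndepFun.comp (_mβ := 𝓕 n) (indepFun_id_block hW hWi n) (hΘ n) measurable_id
  have hcomp (n : ℕ) : eLpNorm (fun ω => G n (Θ n ω, fun i => W (n, i) ω)) (ENNReal.ofReal p) P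
      ≤ ENNReal.ofReal (c * A.σ (n + 1)) :=
    eLpNorm_comp_le_of_indepFun (hΘ' n) (hB n) (hΘB n) (hGm n) hp0 fun θ => by
      rw [← ofReal_lpNorm (hmom n θ).1]
      exact ENNReal.ofReal_le_ofReal (hmom n θ).2.1
  have hL (n : ℕ) : MemLp (fun ω => G n (Θ n ω, fun i => W (n, i) ω)) (ENNReal.ofReal p) P :=
    ⟨((hGm n).comp ((hΘ' n).prodMk (hB n))).aestronglyMeasurable,
      (hcomp n).trans_lt ENNReal.ofReal_lt_top⟩
  refine ⟨⟨fun n => ?_, fun n => (hL n).const_smul (γ n), fun n Y hY hint => ?_⟩, fun n => ?_⟩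
  · exact ((hGm n).comp (((hΘ n).mono (𝓕.mono n.le_succ) le_rfl).prodMk
      (measurable_block hW n))).const_smul (γ n)
  -- the past is represented by the identity into `Ω` with the `σ`-algebra `𝓕 n`
  · refine integral_inner_eq_zero_of_indepFun (mT := 𝓕 n) (H := id)
      (B := fun ω (i : ℕ × ℕ) => W (n, i) ω) (φ := Y)
      (G := fun x => γ n • G n (Θ n x.1, x.2)) (measurable_id.mono le_rfl (𝓕.le n)) (hB n)
      (indepFun_id_block hW hWi n) hY ?_ (fun h => ?_) (fun h => ?_) hint
    · exact ((hGm n).comp (((hΘ n).comp measurable_fst).prodMk measurable_snd)).const_smul (γ n)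
    · exact ((hmom n (Θ n h)).1.integrable hp1).smul (γ n)
    · have := (hmom n (Θ n h)).2.2
      rw [integral_smul]
      exact smul_eq_zero_of_right _ this
  · have h1 : lpNorm (fun ω => G n (Θ n ω, fun i => W (n, i) ω)) (ENNReal.ofReal p) P
        ≤ c * A.σ (n + 1) := by
      rw [← toReal_eLpNorm (hL n).1]
      exact ENNReal.toReal_le_of_le_ofReal (mul_nonneg hc (hσ n).le) (hcomp n)
    have h2 := lpNorm_const_smul (p := ENNReal.ofReal p) (γ n)
      (fun ω => G n (Θ n ω, fun i => W (n, i) ω)) P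
    have hnn : (‖γ n‖₊ : ℝ) = γ n := by rw [coe_nnnorm, Real.norm_of_nonneg (hγ n)]
    rw [hnn] at h2
    exact h2.le.trans (mul_le_mul_of_nonneg_left h1 (hγ n))

/-- The error of the multilevel scheme is a contractive recursion. -/
theorem exists_isContractiveRecursion_scheme
    (p : ℝ) (hp : 2 ≤ p)
    (U : Ω → S) (hU : Measurable U)
    (F : E × S → E) (hFint : ∀ θ, Integrable (fun ω => F (θ, U ω)) P)
    (Fk : ℕ → E × S → E) (hFk0 : ∀ x, Fk 0 x = 0)
    (hFk : ∀ k, 1 ≤ k → Measurable (Fk k))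
    (hFkint : ∀ k, 1 ≤ k → ∀ θ, Integrable (fun ω => Fk k (θ, U ω)) P)
    (C : ℕ → ℝ)
    (θstar : E) (V : ℕ → ℕ → ℕ → Ω → S)
    (hVmeas : ∀ n k l, 1 ≤ n → 1 ≤ k → 1 ≤ l → Measurable (V n k l))
    (hVlaw : ∀ n k l, 1 ≤ n → 1 ≤ k → 1 ≤ l → IdentDistrib (V n k l) U P P)
    (hVindep : iIndepFun (fun i : ℕ+ × ℕ+ × ℕ+ => V (i.1 : ℕ) (i.2.1 : ℕ) (i.2.2 : ℕ)) P)
    (L : ℝ) (hA1 : AssumptionA1 (meanFun P U F) θstar L)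
    (A : Params E) (hC1 : AssumptionC1 P U p F Fk C A) (θ₀ : E)
    (r γ₀ σ₀ ε₀ ρ : ℝ) (hr : -1 < r) (hγ₀ : (1 + r) / (2 * L) < γ₀)
    (hσ₀ : 0 < σ₀) (hε₀ : 0 < ε₀) (hρ : ρ = 1 / 2 * (1 + r))
    (hγ : ∀ n : ℕ, 1 ≤ n → A.γ n = γ₀ * (1 / (n : ℝ)))
    (hσpos : ∀ n : ℕ, 1 ≤ n → 0 < A.σ n)
    (hσ : ∀ n : ℕ, 1 ≤ n → A.σ n ^ 2 = σ₀ ^ 2 * (1 / (n : ℝ) ^ r))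
    (hε : ∀ n : ℕ, 1 ≤ n → A.ε n = ε₀ * (1 / (n : ℝ) ^ ρ)) :
    ∃ (𝓕 : Filtration ℕ mΩ) (lam c : ℝ) (d ζ : ℕ → Ω → E), ρ < lam ∧
      IsContractiveRecursion P 𝓕 p lam ρ c (fun n ω => scheme A Fk V θ₀ n ω - θstar) d ζ := by
  have hL := hA1.L_pos
  have hγ₀pos : 0 < γ₀ := lt_trans (div_pos (by linarith) (by linarith)) hγ₀
  have hργ : ρ < γ₀ * L := by
    rw [div_lt_iff₀ (by linarith)] at hγ₀
    linarith
  have hF (k : ℕ) : Measurable (Fk k) := by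
    rcases Nat.eq_zero_or_pos k with rfl | hk
    · have : Fk 0 = fun _ => 0 := funext hFk0
      rw [this]; exact measurable_const
    · exact hFk k hk
  have hint (k : ℕ) (θ : E) : Integrable (fun ω => Fk k (θ, U ω)) P := by
    rcases Nat.eq_zero_or_pos k with rfl | hk
    · simp only [hFk0]; exact integrable_zero _ _ _
    · exact hFkint k hk θ
  -- the samples, indexed from zero
  set W : ℕ × ℕ × ℕ → Ω → S := fun i => V (i.1 + 1) (i.2.1 + 1) (i.2.2 + 1) with hWdef
  have hW (i) : Measurable (W i) := hVmeas _ _ _ (by omega) (by omega) (by omega)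
  have hWU (i) : IdentDistrib (W i) U P P := hVlaw _ _ _ (by omega) (by omega) (by omega)
  have hinj : Function.Injective fun i : ℕ × ℕ × ℕ =>
      ((Nat.succPNat i.1, Nat.succPNat i.2.1, Nat.succPNat i.2.2) : ℕ+ × ℕ+ × ℕ+) := by
    rintro ⟨a, b, c⟩ ⟨a', b', c'⟩ h
    simpa [Prod.ext_iff] using h
  have hWi : iIndepFun W P := hVindep.precomp hinj
  obtain ⟨c₁, hc₁, hmom⟩ := exists_lpNorm_levelSum_le hp hFk0 hF hint hU hC1
  have hσ' (n : ℕ) : 0 < A.σ (n + 1) := hσpos (n + 1) (by omega)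
  have hmom' (n : ℕ) (θ : E) := hmom (fun i => W (n, i)) (fun i => hW (n, i))
    (fun i => hWU (n, i)) (hWi.precomp (Prod.mk_right_injective n)) (n + 1) θ (hσ' n)
  obtain ⟨c₂, hc₂, hf⟩ := hA1.exists_norm_le
  obtain ⟨n₀, hn₀⟩ := hA1.exists_contraction hγ₀pos
    (by linarith : (γ₀ * L + ρ) / 2 < γ₀ * L)
  set 𝓕 := pastFiltration W hW with h𝓕
  set θ : ℕ → Ω → E := scheme A Fk V θ₀ with hθ
  set g : ℕ → E → E := fun n => levelMean P U A Fk (n + 1) with hg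
  have hgm (n : ℕ) : Measurable (g n) := measurable_levelMean hF hU hC1.measurable_Γ₂ (n + 1)
  have hγ' (n : ℕ) : A.γ (n + 1) = γ₀ / (n + 1) := by
    rw [hγ (n + 1) (by omega)]; push_cast; ring
  have hγn (n : ℕ) : 0 ≤ A.γ (n + 1) := by rw [hγ']; positivity
  have hε' (n : ℕ) : A.ε (n + 1) = ε₀ * ((n : ℝ) + 1) ^ (-ρ) := by
    rw [hε (n + 1) (by omega), Real.rpow_neg (by positivity)]; push_cast; ring
  have hσ'' (n : ℕ) : A.σ (n + 1) = σ₀ * ((n : ℝ) + 1) ^ (-(r / 2)) := by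
    have hm : (0 : ℝ) < n + 1 := by positivity
    refine (pow_left_inj₀ (hσ' n).le (by positivity) two_ne_zero).1 ?_
    rw [hσ (n + 1) (by omega), mul_pow, ← Real.rpow_natCast (_ ^ (-(r / 2))), ← Real.rpow_mul hm.le,
      one_div, ← Real.rpow_neg (by positivity)]
    push_cast
    congr 2; ring
  have hb (n : ℕ) (x : E) : ‖g n x - meanFun P U F x‖ ≤ ε₀ * ((n : ℝ) + 1) ^ (-ρ) := by
    rw [← hε' n]
    exact norm_levelMean_sub_meanFun_le hC1 hFint hint (by rw [hε']; positivity) x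
  have hstep (n : ℕ) (ω : Ω) : θ (n + 1) ω = θ n ω
      + A.γ (n + 1) • levelSum A Fk (n + 1) (θ n ω) (fun i => W (n, i) ω) := by
    rw [hθ, scheme, estimator_eq_levelSum]
  have hθm (n : ℕ) : Measurable[𝓕 n] (θ n) := by
    induction n with
    | zero => exact measurable_const
    | succ n ih =>
      have ih' := ih.mono (𝓕.mono n.le_succ) le_rfl
      rw [funext (hstep n)]
      exact ih'.add (((measurable_levelSum hF hC1.measurable_Γ₁ hC1.measurable_Γ₂ (n + 1)).comp
        (ih'.prodMk (measurable_block hW n))).const_smul _)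
  obtain ⟨hmd, hmdle⟩ := isMartingaleDiff_levelSum hp hF hU hC1.measurable_Γ₁ hC1.measurable_Γ₂ hW
    hWi hc₁.le hmom' hσ' (fun n => A.γ (n + 1)) hγn hθm
  have hrpow (n : ℕ) : ((n : ℝ) + 1) ^ (-(1 + ρ)) = ((n : ℝ) + 1) ^ (-ρ) / (n + 1) := by
    rw [← Real.rpow_sub_one (by positivity)]; ring_nf
  set c := γ₀ * c₂ + γ₀ * ε₀ + γ₀ * c₁ * σ₀ with hc
  have hq1 : 0 ≤ γ₀ * c₂ := by positivity
  have hq2 : 0 ≤ γ₀ * ε₀ := by positivity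
  have hq3 : 0 ≤ γ₀ * c₁ * σ₀ := by positivity
  have hbias (n : ℕ) (x : E) : ‖(γ₀ / ((n : ℝ) + 1)) • (g n x - meanFun P U F x)‖
      ≤ c * ((n : ℝ) + 1) ^ (-(1 + ρ)) := by
    rw [norm_smul, Real.norm_of_nonneg (by positivity), hrpow]
    calc _ ≤ γ₀ / ((n : ℝ) + 1) * (ε₀ * ((n : ℝ) + 1) ^ (-ρ)) :=
          mul_le_mul_of_nonneg_left (hb n x) (by positivity)
      _ = (γ₀ * ε₀) * (((n : ℝ) + 1) ^ (-ρ) / (n + 1)) := by ring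
      _ ≤ _ := mul_le_mul_of_nonneg_right (by linarith) (by positivity)
  have hsplit (n : ℕ) (x : E) : A.γ (n + 1) • g n x = (γ₀ / ((n : ℝ) + 1)) • meanFun P U F x
      + (γ₀ / ((n : ℝ) + 1)) • (g n x - meanFun P U F x) := by
    rw [hγ', ← smul_add, add_sub_cancel]
  refine ⟨𝓕, (γ₀ * L + ρ) / 2, c, fun n ω => A.γ (n + 1) • g n (θ n ω), _, by linarith, hmd, ?_,
    ?_, fun n => ?_, fun n ω => ?_, fun n ω => ?_, ⟨n₀, fun n hn ω => ?_⟩, fun n => ?_, by linarith⟩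
  · exact memLp_const (θ₀ - θstar)
  · exact (hθm 0).sub_const θstar
  · exact ((hgm n).comp (hθm n)).const_smul _
  · simp only [hstep, smul_sub, hg]
    abel
  · rw [hsplit]
    refine (norm_add_le _ _).trans (add_le_add ?_ (hbias n _))
    rw [norm_smul, Real.norm_of_nonneg (by positivity)]
    calc _ ≤ γ₀ / ((n : ℝ) + 1) * (c₂ * ‖θ n ω - θstar‖) :=
          mul_le_mul_of_nonneg_left (hf _) (by positivity)
      _ = γ₀ * c₂ / ((n : ℝ) + 1) * ‖θ n ω - θstar‖ := by ring
      _ ≤ _ := by gcongr; linarith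
  · rw [hsplit, ← add_assoc]
    exact (norm_add_le _ _).trans (add_le_add (hn₀ n hn _) (hbias n _))
  · refine (hmdle n).trans ?_
    have hm : (0 : ℝ) < n + 1 := by positivity
    have e : ((n : ℝ) + 1) ^ (-(1 / 2 + ρ)) = ((n : ℝ) + 1) ^ (-(r / 2)) / (n + 1) := by
      rw [← Real.rpow_sub_one hm.ne', hρ]; ring_nf
    rw [hσ'', hγ', e]
    calc _ = (γ₀ * c₁ * σ₀) * (((n : ℝ) + 1) ^ (-(r / 2)) / (n + 1)) := by ring
      _ ≤ _ := mul_le_mul_of_nonneg_right (by linarith) (by positivity)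

end MLRM

/-! ### Cost of the scheme -/

namespace MLRM

/-- The factor by which the order of the cost bound exceeds `n ^ (2 ρ)`. -/
noncomputable def costFactor (α β ρ : ℝ) (n : ℕ) : ℝ :=
  if 1 / 2 < β then 1
  else if β = 1 / 2 then Real.log ((n : ℝ) + 1) ^ 2
  else (n : ℝ) ^ (ρ * ((1 - 2 * β) / α))

lemma costRate_eq (α β ρ : ℝ) {n : ℕ} (hn : 1 ≤ n) :
    costRate α β ρ n = (n : ℝ) ^ (2 * ρ) * costFactor α β ρ n := by
  have hn0 : (0 : ℝ) < n := by exact_mod_cast hn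
  unfold costRate costFactor
  split_ifs
  · rw [mul_one]
  · rfl
  · rw [← Real.rpow_add hn0]; congr 1; ring

lemma half_le_log_add_one {n : ℕ} (hn : 1 ≤ n) : 1 / 2 ≤ Real.log ((n : ℝ) + 1) := by
  have h1 : (1 : ℝ) ≤ n := by exact_mod_cast hn
  have h2 : Real.log 2 ≤ Real.log ((n : ℝ) + 1) := Real.log_le_log (by norm_num) (by linarith)
  linarith [Real.log_two_gt_d9]

lemma quarter_le_costFactor {α β ρ : ℝ} (hα : 0 < α) (hρ : 0 < ρ) {n : ℕ} (hn : 1 ≤ n) :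
    1 / 4 ≤ costFactor α β ρ n := by
  have h1 : (1 : ℝ) ≤ n := by exact_mod_cast hn
  unfold costFactor
  split_ifs with h h'
  · norm_num
  · have := half_le_log_add_one hn
    nlinarith
  · have hβ : β < 1 / 2 := lt_of_le_of_ne (not_lt.1 h) h'
    have : 0 ≤ ρ * ((1 - 2 * β) / α) :=
      mul_nonneg hρ.le (div_nonneg (by linarith) hα.le)
    linarith [Real.one_le_rpow h1 this]

lemma costFactor_mono {α β ρ : ℝ} (hα : 0 < α) (hρ : 0 < ρ) {m n : ℕ} (hm : 1 ≤ m) (hmn : m ≤ n) :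
    costFactor α β ρ m ≤ costFactor α β ρ n := by
  have h1 : (m : ℝ) ≤ n := by exact_mod_cast hmn
  unfold costFactor
  split_ifs with h h'
  · exact le_rfl
  · have h2 := half_le_log_add_one hm
    have h3 : Real.log ((m : ℝ) + 1) ≤ Real.log ((n : ℝ) + 1) :=
      Real.log_le_log (by positivity) (by linarith)
    exact pow_le_pow_left₀ (by linarith) h3 2
  · have hβ : β < 1 / 2 := lt_of_le_of_ne (not_lt.1 h) h'
    exact Real.rpow_le_rpow (by positivity) h1
      (mul_nonneg hρ.le (div_nonneg (by linarith) hα.le))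

/-- The condition on `r` makes the contribution of the summands `1` in `N ≤ κ M ^ (…) + 1` to the
cost negligible. -/
lemma rpow_div_le_costFactor {α β ρ r : ℝ} (hα : 0 < α) (hρ0 : 0 < ρ)
    (hρ : ρ = 1 / 2 * (1 + r)) (hαβ : min β (1 / 2) < α)
    (hr : min β (1 / 2) / (α - min β (1 / 2)) < r) {n : ℕ} (hn : 1 ≤ n) :
    (n : ℝ) ^ (ρ / α) ≤ 4 * ((n : ℝ) ^ r * costFactor α β ρ n) := by
  have h1 : (1 : ℝ) ≤ n := by exact_mod_cast hn
  have hn0 : (0 : ℝ) < n := by linarith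
  rw [div_lt_iff₀ (by linarith)] at hr
  rcases le_or_gt (1 / 2) β with h | h
  · rw [min_eq_right h] at hr
    have h2 : ρ / α ≤ r := by rw [div_le_iff₀ hα]; linarith
    have h3 := Real.rpow_le_rpow_of_exponent_le h1 h2
    have h4 := quarter_le_costFactor (β := β) hα hρ0 hn
    have := mul_le_mul_of_nonneg_left h4 (Real.rpow_nonneg hn0.le r)
    linarith
  · rw [min_eq_left h.le] at hr
    have e : costFactor α β ρ n = (n : ℝ) ^ (ρ * ((1 - 2 * β) / α)) := by
      rw [costFactor, if_neg (not_lt.2 h.le), if_neg h.ne]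
    rw [e, ← Real.rpow_add hn0]
    have h2 : ρ / α ≤ r + ρ * ((1 - 2 * β) / α) := by
      rw [div_le_iff₀ hα, add_mul, mul_assoc, div_mul_cancel₀ _ hα.ne']
      rw [hρ]
      linarith
    have h3 := Real.rpow_le_rpow_of_exponent_le h1 h2
    have : 0 ≤ (n : ℝ) ^ (r + ρ * ((1 - 2 * β) / α)) := by positivity
    linarith

lemma sum_rpow_mul_costFactor_le {α β ρ r : ℝ} (hα : 0 < α) (hρ0 : 0 < ρ)
    (hρ : ρ = 1 / 2 * (1 + r)) (hr : 0 ≤ r) {n : ℕ} (hn : 1 ≤ n) :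
    ∑ j ∈ Finset.Icc 1 n, (j : ℝ) ^ r * costFactor α β ρ j ≤ costRate α β ρ n := by
  have hn0 : (0 : ℝ) < n := by exact_mod_cast hn
  have h : ∀ j ∈ Finset.Icc 1 n, (j : ℝ) ^ r * costFactor α β ρ j
      ≤ (n : ℝ) ^ r * costFactor α β ρ n := fun j hj => by
    obtain ⟨h1, h2⟩ := Finset.mem_Icc.1 hj
    have h3 : (j : ℝ) ≤ n := by exact_mod_cast h2
    have h4 := quarter_le_costFactor (β := β) hα hρ0 h1
    exact mul_le_mul (Real.rpow_le_rpow (by positivity) h3 hr) (costFactor_mono hα hρ0 h1 h2)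
      (by linarith) (by positivity)
  refine (Finset.sum_le_sum h).trans (le_of_eq ?_)
  rw [Finset.sum_const, Nat.card_Icc, nsmul_eq_mul, costRate_eq α β ρ hn, ← mul_assoc,
    Nat.add_sub_cancel, ← Real.rpow_one_add' hn0.le (by linarith)]
  congr 2
  linarith

section Pointwise

variable {E : Type*} [NormedAddCommGroup E] {A : Params E} {p ε₀ σ₀ ρ r K₁ β₁ : ℝ}

/-- The maximal level exceeds its logarithmic lower bound by at most `1`. -/
lemma exists_maxLevel_le (hM : 1 < A.M) (hα : 0 < A.α) (hp : 0 < p) (hε₀ : 0 < ε₀) (hρ : 0 < ρ)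
    (hε : ∀ n : ℕ, 1 ≤ n → A.ε n = ε₀ * (1 / (n : ℝ) ^ ρ)) (hΓ₂ : ∀ θ, 0 < A.Γ₂ θ)
    (hbound : ∀ θ : E, A.Γ₂ θ ≤ K₁ * (1 + ‖θ‖) ^ (A.α * p)) :
    ∃ c : ℝ, 1 ≤ c ∧ ∀ (n : ℕ) (θ : E), 1 ≤ n →
      (maxLevel A n θ : ℝ) ≤ 1 + 1 / A.α * Real.logb A.M (c * (n : ℝ) ^ ρ * (1 + ‖θ‖) ^ (A.α * p)) := by
  refine ⟨max 1 (K₁ / ε₀), le_max_left _ _, fun n θ hn => ?_⟩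
  have h1 : (1 : ℝ) ≤ n := by exact_mod_cast hn
  have hn0 : (0 : ℝ) < n := by linarith
  have hT : 1 ≤ 1 + ‖θ‖ := by linarith [norm_nonneg θ]
  set Q := max 1 (K₁ / ε₀) * (n : ℝ) ^ ρ * (1 + ‖θ‖) ^ (A.α * p) with hQ
  have hQ1 : 1 ≤ Q := one_le_mul_of_one_le_of_one_le
    (one_le_mul_of_one_le_of_one_le (le_max_left _ _) (Real.one_le_rpow h1 hρ.le))
    (Real.one_le_rpow hT (by positivity))
  have hle : A.Γ₂ θ / A.ε n ≤ Q := by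
    rw [hε n hn, div_le_iff₀ (by positivity)]
    calc A.Γ₂ θ ≤ K₁ * (1 + ‖θ‖) ^ (A.α * p) := hbound θ
      _ = (K₁ / ε₀) * (1 + ‖θ‖) ^ (A.α * p) * ε₀ := by field_simp
      _ ≤ max 1 (K₁ / ε₀) * (1 + ‖θ‖) ^ (A.α * p) * ε₀ := by gcongr; exact le_max_right _ _
      _ = _ := by rw [hQ]; field_simp
  have hy0 : 0 ≤ 1 / A.α * Real.logb A.M Q :=
    mul_nonneg (by positivity) (Real.logb_nonneg hM hQ1)
  have hpos : 0 < A.Γ₂ θ / A.ε n := div_pos (hΓ₂ θ) (by rw [hε n hn]; positivity)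
  have hxy : 1 / A.α * Real.logb A.M (A.Γ₂ θ / A.ε n) ≤ 1 / A.α * Real.logb A.M Q :=
    mul_le_mul_of_nonneg_left (Real.logb_le_logb_of_le hM hpos hle) (by positivity)
  unfold maxLevel
  rw [Nat.cast_max, Nat.cast_one]
  refine max_le (by linarith) ?_
  have h2 : (⌈1 / A.α * Real.logb A.M (A.Γ₂ θ / A.ε n)⌉₊ : ℝ)
      ≤ ⌈1 / A.α * Real.logb A.M Q⌉₊ := by exact_mod_cast Nat.ceil_mono hxy
  linarith [Nat.ceil_lt_add_one hy0]

lemma exists_rpow_maxLevel_le (hM : 1 < A.M) (hα : 0 < A.α) (hp : 0 < p) (hε₀ : 0 < ε₀) (hρ : 0 < ρ)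
    (hε : ∀ n : ℕ, 1 ≤ n → A.ε n = ε₀ * (1 / (n : ℝ) ^ ρ)) (hΓ₂ : ∀ θ, 0 < A.Γ₂ θ)
    (hbound : ∀ θ : E, A.Γ₂ θ ≤ K₁ * (1 + ‖θ‖) ^ (A.α * p)) :
    ∃ c : ℝ, 0 < c ∧ ∀ (n : ℕ) (θ : E), 1 ≤ n →
      A.M ^ (maxLevel A n θ : ℝ) ≤ c * ((n : ℝ) ^ (ρ / A.α) * (1 + ‖θ‖) ^ p) := by
  obtain ⟨c, hc, h⟩ := exists_maxLevel_le hM hα hp hε₀ hρ hε hΓ₂ hbound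
  have hM0 : 0 < A.M := by linarith
  have hc0 : 0 < c := by linarith
  refine ⟨A.M * c ^ (1 / A.α), by positivity, fun n θ hn => ?_⟩
  have hn0 : (0 : ℝ) < n := by exact_mod_cast hn
  have hT : 0 < 1 + ‖θ‖ := by linarith [norm_nonneg θ]
  refine (Real.rpow_le_rpow_of_exponent_le hM.le (h n θ hn)).trans (le_of_eq ?_)
  rw [Real.rpow_add hM0, Real.rpow_one, mul_comm (1 / A.α), Real.rpow_mul hM0.le,
    Real.rpow_logb hM0 hM.ne' (by positivity), Real.mul_rpow (by positivity) (by positivity),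
    Real.mul_rpow (by positivity) (by positivity), ← Real.rpow_mul hn0.le, ← Real.rpow_mul hT.le]
  have e1 : ρ * (1 / A.α) = ρ / A.α := by ring
  have e2 : A.α * p * (1 / A.α) = p := by field_simp
  rw [e1, e2]
  ring

/-- For `β = 1/2` the maximal level is of the order of the logarithm, up to small powers of `‖θ‖`. -/
lemma exists_maxLevel_le_log (hM : 1 < A.M) (hα : 0 < A.α) (hp : 0 < p) (hε₀ : 0 < ε₀) (hρ : 0 < ρ)
    (hε : ∀ n : ℕ, 1 ≤ n → A.ε n = ε₀ * (1 / (n : ℝ) ^ ρ)) (hΓ₂ : ∀ θ, 0 < A.Γ₂ θ)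
    (hbound : ∀ θ : E, A.Γ₂ θ ≤ K₁ * (1 + ‖θ‖) ^ (A.α * p)) {δ : ℝ} (hδ : 0 < δ) :
    ∃ c : ℝ, 0 < c ∧ ∀ (n : ℕ) (θ : E), 1 ≤ n →
      (maxLevel A n θ : ℝ) ≤ c * (Real.log ((n : ℝ) + 1) * (1 + ‖θ‖) ^ δ) := by
  obtain ⟨c, hc, h⟩ := exists_maxLevel_le hM hα hp hε₀ hρ hε hΓ₂ hbound
  have hlM : 0 < Real.log A.M := Real.log_pos hM
  have hlc : 0 ≤ Real.log c := Real.log_nonneg hc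
  have hc0 : 0 < c := by linarith
  refine ⟨2 + 1 / A.α * ((2 * Real.log c + ρ + 2 * (A.α * p / δ)) / Real.log A.M), by positivity,
    fun n θ hn => ?_⟩
  have h1 : (1 : ℝ) ≤ n := by exact_mod_cast hn
  have hn0 : (0 : ℝ) < n := by linarith
  have hT1 : 1 ≤ 1 + ‖θ‖ := by linarith [norm_nonneg θ]
  have hT : 0 < 1 + ‖θ‖ := by linarith
  set ℓ := Real.log ((n : ℝ) + 1) with hℓ
  set τ := (1 + ‖θ‖) ^ δ with hτ
  have hτ1 : 1 ≤ τ := Real.one_le_rpow hT1 hδ.le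
  have hℓ1 : 1 / 2 ≤ ℓ := half_le_log_add_one hn
  have g1 : 1 ≤ 2 * (ℓ * τ) := by nlinarith
  have g2 : Real.log n ≤ ℓ * τ := by
    have : Real.log n ≤ ℓ := Real.log_le_log hn0 (by linarith)
    nlinarith
  have g3 : Real.log (1 + ‖θ‖) ≤ 2 * (ℓ * τ) / δ := by
    refine (Real.log_le_rpow_div hT.le hδ).trans ?_
    gcongr
    nlinarith
  have hlog : Real.log (c * (n : ℝ) ^ ρ * (1 + ‖θ‖) ^ (A.α * p))
      ≤ (2 * Real.log c + ρ + 2 * (A.α * p / δ)) * (ℓ * τ) := by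
    rw [Real.log_mul (by positivity) (by positivity), Real.log_mul (by positivity) (by positivity),
      Real.log_rpow hn0, Real.log_rpow hT]
    have k1 := mul_le_mul_of_nonneg_left g1 hlc
    have k2 := mul_le_mul_of_nonneg_left g2 hρ.le
    have k3 := mul_le_mul_of_nonneg_left g3 (by positivity : 0 ≤ A.α * p)
    have : A.α * p * (2 * (ℓ * τ) / δ) = 2 * (A.α * p / δ) * (ℓ * τ) := by ring
    linarith
  have hm := h n θ hn
  rw [Real.logb] at hm
  have k : 1 / A.α * (Real.log (c * (n : ℝ) ^ ρ * (1 + ‖θ‖) ^ (A.α * p)) / Real.log A.M)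
      ≤ 1 / A.α * ((2 * Real.log c + ρ + 2 * (A.α * p / δ)) * (ℓ * τ) / Real.log A.M) := by
    gcongr
  have e : 1 / A.α * ((2 * Real.log c + ρ + 2 * (A.α * p / δ)) * (ℓ * τ) / Real.log A.M)
    = 1 / A.α * ((2 * Real.log c + ρ + 2 * (A.α * p / δ)) / Real.log A.M) * (ℓ * τ) := by ring
  linarith

/-- The growth condition on `Γ₁` is what keeps the cost of one step bounded by `(1 + ‖θ‖) ^ p`. -/
lemma exists_sq_mul_levelWeight_sq_le (hM : 1 < A.M) (hα : 0 < A.α) (hp : 0 < p)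
    (hε₀ : 0 < ε₀) (hρ : 0 < ρ)
    (hε : ∀ n : ℕ, 1 ≤ n → A.ε n = ε₀ * (1 / (n : ℝ) ^ ρ)) (hΓ₁ : ∀ θ, 0 < A.Γ₁ θ)
    (hΓ₂ : ∀ θ, 0 < A.Γ₂ θ) (hC2 : AssumptionC2 p A) :
    ∃ c : ℝ, 0 < c ∧ ∀ (n : ℕ) (θ : E), 1 ≤ n →
      A.Γ₁ θ ^ 2 * levelWeight A (maxLevel A n θ) ^ 2
        ≤ c * (costFactor A.α A.β ρ n * (1 + ‖θ‖) ^ p) := by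
  obtain ⟨K₁, β₁, hK₁, hβ₁, hne, heq, hbound⟩ := hC2
  have hM0 : 0 < A.M := by linarith
  have hΓsq (θ : E) : A.Γ₁ θ ^ 2 ≤ K₁ ^ 2 * (1 + ‖θ‖) ^ (2 * β₁ * p) := by
    have hT : 0 < 1 + ‖θ‖ := by linarith [norm_nonneg θ]
    refine (pow_le_pow_left₀ (hΓ₁ θ).le (hbound θ).1 2).trans (le_of_eq ?_)
    rw [mul_pow, ← Real.rpow_natCast (_ ^ (β₁ * p)), ← Real.rpow_mul hT.le]
    congr 2; push_cast; ring
  rcases lt_trichotomy A.β (1 / 2) with h | h | h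
  · obtain ⟨c, hc, hpow⟩ := exists_rpow_maxLevel_le hM hα hp hε₀ hρ hε hΓ₂ fun θ => (hbound θ).2
    have hβ₁' : β₁ ≤ A.β := (hne h.ne).trans (min_le_left _ _)
    have hs : 0 < 1 - 2 * A.β := by linarith
    refine ⟨K₁ ^ 2 * c ^ (1 - 2 * A.β), by positivity, fun n θ hn => ?_⟩
    have hn0 : (0 : ℝ) < n := by exact_mod_cast hn
    have hT1 : 1 ≤ 1 + ‖θ‖ := by linarith [norm_nonneg θ]
    have hT : 0 < 1 + ‖θ‖ := by linarith
    have hw : levelWeight A (maxLevel A n θ) ^ 2 = (A.M ^ (maxLevel A n θ : ℝ)) ^ (1 - 2 * A.β) := by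
      rw [levelWeight, if_neg h.ne, max_eq_left (by linarith), ← Real.rpow_natCast,
        ← Real.rpow_mul hM0.le, ← Real.rpow_mul hM0.le]
      congr 1; push_cast; ring
    have hcf : costFactor A.α A.β ρ n = ((n : ℝ) ^ (ρ / A.α)) ^ (1 - 2 * A.β) := by
      rw [costFactor, if_neg (not_lt.2 h.le), if_neg h.ne, ← Real.rpow_mul hn0.le]
      congr 1; ring
    have h1 := Real.rpow_le_rpow (by positivity) (hpow n θ hn) hs.le
    rw [Real.mul_rpow hc.le (by positivity), Real.mul_rpow (by positivity) (by positivity),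
      ← hcf, ← hw] at h1
    have h0 : 0 ≤ costFactor A.α A.β ρ n := by rw [hcf]; positivity
    have h2 : (1 + ‖θ‖) ^ (2 * β₁ * p) * ((1 + ‖θ‖) ^ p) ^ (1 - 2 * A.β) ≤ (1 + ‖θ‖) ^ p := by
      rw [← Real.rpow_mul hT.le, ← Real.rpow_add hT]
      refine Real.rpow_le_rpow_of_exponent_le hT1 ?_
      nlinarith
    calc _ ≤ K₁ ^ 2 * (1 + ‖θ‖) ^ (2 * β₁ * p) * (c ^ (1 - 2 * A.β) *
            (costFactor A.α A.β ρ n * ((1 + ‖θ‖) ^ p) ^ (1 - 2 * A.β))) :=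
          mul_le_mul (hΓsq θ) h1 (by positivity) (by positivity)
      _ = K₁ ^ 2 * c ^ (1 - 2 * A.β) * (costFactor A.α A.β ρ n *
            ((1 + ‖θ‖) ^ (2 * β₁ * p) * ((1 + ‖θ‖) ^ p) ^ (1 - 2 * A.β))) := by ring
      _ ≤ _ := by gcongr
  · have hβ₁' := heq h
    -- `2 β₁ p + 2 δ = p` for this `δ`; strictness of `β₁ < 1/2` leaves room for the logarithm of `‖θ‖`
    have hδ : 0 < p * (1 / 2 - β₁) := mul_pos hp (by linarith)
    obtain ⟨c, hc, hlog⟩ := exists_maxLevel_le_log hM hα hp hε₀ hρ hε hΓ₂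
      (fun θ => (hbound θ).2) hδ
    refine ⟨K₁ ^ 2 * c ^ 2, by positivity, fun n θ hn => ?_⟩
    have hT : 0 < 1 + ‖θ‖ := by linarith [norm_nonneg θ]
    have hw : levelWeight A (maxLevel A n θ) = maxLevel A n θ := by rw [levelWeight, if_pos h]
    have hcf : costFactor A.α A.β ρ n = Real.log ((n : ℝ) + 1) ^ 2 := by
      rw [costFactor, if_neg (by rw [h]; exact lt_irrefl _), if_pos h]
    rw [hw, hcf]
    have h1 := pow_le_pow_left₀ (Nat.cast_nonneg _) (hlog n θ hn) 2
    have h2 : (1 + ‖θ‖) ^ p = (1 + ‖θ‖) ^ (2 * β₁ * p) * ((1 + ‖θ‖) ^ (p * (1 / 2 - β₁))) ^ 2 := by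
      rw [← Real.rpow_natCast (_ ^ (p * (1 / 2 - β₁))), ← Real.rpow_mul hT.le, ← Real.rpow_add hT]
      congr 1; push_cast; ring
    calc _ ≤ K₁ ^ 2 * (1 + ‖θ‖) ^ (2 * β₁ * p) *
            (c * (Real.log ((n : ℝ) + 1) * (1 + ‖θ‖) ^ (p * (1 / 2 - β₁)))) ^ 2 :=
          mul_le_mul (hΓsq θ) h1 (by positivity) (by positivity)
      _ = _ := by rw [h2]; ring
  · have hβ₁' : β₁ ≤ 1 / 2 := (hne h.ne').trans (min_le_right _ _)
    refine ⟨K₁ ^ 2, by positivity, fun n θ hn => ?_⟩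
    have hT1 : 1 ≤ 1 + ‖θ‖ := by linarith [norm_nonneg θ]
    have hw : levelWeight A (maxLevel A n θ) = 1 := by
      rw [levelWeight, if_neg h.ne', max_eq_right (by linarith), mul_zero, Real.rpow_zero]
    have hcf : costFactor A.α A.β ρ n = 1 := by rw [costFactor, if_pos h]
    rw [hw, hcf, one_pow, mul_one, one_mul]
    refine (hΓsq θ).trans (mul_le_mul_of_nonneg_left ?_ (by positivity))
    refine Real.rpow_le_rpow_of_exponent_le hT1 ?_
    nlinarith

/-- The cost of one evaluation of the multilevel estimator. -/
lemma exists_sum_numIter_mul_le (hM : 1 < A.M) (hα : 0 < A.α) (hp : 0 < p)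
    (hε₀ : 0 < ε₀) (hσ₀ : 0 < σ₀) (hρ0 : 0 < ρ) (hρ : ρ = 1 / 2 * (1 + r))
    (hε : ∀ n : ℕ, 1 ≤ n → A.ε n = ε₀ * (1 / (n : ℝ) ^ ρ))
    (hσpos : ∀ n : ℕ, 1 ≤ n → 0 < A.σ n)
    (hσ : ∀ n : ℕ, 1 ≤ n → A.σ n ^ 2 = σ₀ ^ 2 * (1 / (n : ℝ) ^ r))
    (hΓ₁ : ∀ θ, 0 < A.Γ₁ θ) (hΓ₂ : ∀ θ, 0 < A.Γ₂ θ) (hC2 : AssumptionC2 p A)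
    (hαβ : min A.β (1 / 2) < A.α) (hr : min A.β (1 / 2) / (A.α - min A.β (1 / 2)) < r)
    {C : ℕ → ℝ} {K : ℝ} (hK : 0 < K) (hC : ∀ k : ℕ, 1 ≤ k → C k ≤ K * A.M ^ k) :
    ∃ c : ℝ, 0 < c ∧ ∀ (n : ℕ) (θ : E), 1 ≤ n →
      ∑ k ∈ Finset.Icc 1 (maxLevel A n θ), (numIter A n k θ : ℝ) * C k
        ≤ c * ((n : ℝ) ^ r * costFactor A.α A.β ρ n) * (1 + ‖θ‖) ^ p := by
  have hM0 : 0 < A.M := by linarith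
  have hM1 : 0 < A.M - 1 := by linarith
  obtain ⟨c₁, hc₁, hsq⟩ := exists_sq_mul_levelWeight_sq_le hM hα hp hε₀ hρ0 hε hΓ₁ hΓ₂ hC2
  obtain ⟨c₂, hc₂, hgeo⟩ := exists_sum_rpow_le_levelWeight (A := A) hM
  obtain ⟨K₁, β₁, hK₁, -, -, -, hbound⟩ := hC2
  obtain ⟨c₃, hc₃, hpow⟩ := exists_rpow_maxLevel_le hM hα hp hε₀ hρ0 hε hΓ₂ fun θ => (hbound θ).2
  refine ⟨K * (c₂ * c₁ / σ₀ ^ 2 + A.M / (A.M - 1) * (c₃ * 4)), by positivity, fun n θ hn => ?_⟩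
  have h1 : (1 : ℝ) ≤ n := by exact_mod_cast hn
  have hn0 : (0 : ℝ) < n := by linarith
  have hT : 0 < 1 + ‖θ‖ := by linarith [norm_nonneg θ]
  set m := maxLevel A n θ with hm
  set κ := iterFactor A n θ with hκ
  have hκ0 : 0 < κ := iterFactor_pos hM (hσpos n hn) (hΓ₁ θ)
  rw [sum_Icc_one_eq_sum_range]
  have hterm (k : ℕ) : (numIter A n (k + 1) θ : ℝ) * C (k + 1)
      ≤ K * (κ * A.M ^ (((k : ℝ) + 1) * (1 / 2 - A.β)) + A.M * A.M ^ k) := by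
    have hN : (numIter A n (k + 1) θ : ℝ) ≤ κ * A.M ^ (-(((k : ℝ) + 1) * (A.β + 1 / 2))) + 1 := by
      have := (Nat.ceil_lt_add_one (by positivity :
        0 ≤ κ * A.M ^ (-((((k + 1 : ℕ)) : ℝ) * (A.β + 1 / 2))))).le
      rw [numIter]
      push_cast at this ⊢
      exact this
    calc (numIter A n (k + 1) θ : ℝ) * C (k + 1)
        ≤ (numIter A n (k + 1) θ : ℝ) * (K * A.M ^ (k + 1)) :=
          mul_le_mul_of_nonneg_left (hC (k + 1) (by omega)) (Nat.cast_nonneg _)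
      _ ≤ (κ * A.M ^ (-(((k : ℝ) + 1) * (A.β + 1 / 2))) + 1) * (K * A.M ^ (k + 1)) := by gcongr
      _ = K * (κ * (A.M ^ (-(((k : ℝ) + 1) * (A.β + 1 / 2))) * A.M ^ (k + 1)) + A.M * A.M ^ k) := by
          rw [pow_succ]; ring
      _ = _ := by
          rw [← Real.rpow_natCast A.M (k + 1), ← Real.rpow_add hM0]
          congr 4; push_cast; ring
  refine (Finset.sum_le_sum fun k _ => hterm k).trans ?_
  rw [← Finset.mul_sum, Finset.sum_add_distrib, ← Finset.mul_sum, ← Finset.mul_sum]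
  set R := (n : ℝ) ^ r * costFactor A.α A.β ρ n with hR
  have hp1 : κ * ∑ k ∈ Finset.range m, A.M ^ (((k : ℝ) + 1) * (1 / 2 - A.β))
      ≤ c₂ * c₁ / σ₀ ^ 2 * R * (1 + ‖θ‖) ^ p := by
    refine (mul_le_mul_of_nonneg_left (hgeo m) hκ0.le).trans ?_
    have e1 : κ * (c₂ * levelWeight A m)
        = c₂ * (n : ℝ) ^ r / σ₀ ^ 2 * (A.Γ₁ θ ^ 2 * levelWeight A m ^ 2) := by
      rw [hκ, iterFactor_eq, div_pow, hσ n hn, ← hm]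
      field_simp
    rw [e1]
    refine (mul_le_mul_of_nonneg_left (hsq n θ hn) (by positivity)).trans (le_of_eq ?_)
    rw [hR]; ring
  have hp2 : A.M * ∑ k ∈ Finset.range m, A.M ^ k
      ≤ A.M / (A.M - 1) * (c₃ * 4) * R * (1 + ‖θ‖) ^ p := by
    have e1 : A.M * ∑ k ∈ Finset.range m, A.M ^ k ≤ A.M / (A.M - 1) * A.M ^ (m : ℝ) := by
      rw [geom_sum_eq hM.ne', Real.rpow_natCast, div_mul_eq_mul_div, mul_div_assoc']
      gcongr
      linarith
    refine e1.trans ?_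
    calc A.M / (A.M - 1) * A.M ^ (m : ℝ)
        ≤ A.M / (A.M - 1) * (c₃ * ((n : ℝ) ^ (ρ / A.α) * (1 + ‖θ‖) ^ p)) := by
          gcongr; exact hpow n θ hn
      _ ≤ A.M / (A.M - 1) * (c₃ * (4 * R * (1 + ‖θ‖) ^ p)) := by
          gcongr; exact rpow_div_le_costFactor hα hρ0 hρ hαβ hr hn
      _ = _ := by ring
  calc _ ≤ K * (c₂ * c₁ / σ₀ ^ 2 * R * (1 + ‖θ‖) ^ p
        + A.M / (A.M - 1) * (c₃ * 4) * R * (1 + ‖θ‖) ^ p) :=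
        mul_le_mul_of_nonneg_left (add_le_add hp1 hp2) hK.le
    _ = _ := by ring

end Pointwise

section Cost

variable {E : Type*} [NormedAddCommGroup E] [InnerProductSpace ℝ E]
variable {Ω : Type*} [MeasurableSpace Ω] {P : Measure Ω} [IsProbabilityMeasure P] {S : Type*}

/-- A cost bound per step in terms of `(1 + ‖θ‖) ^ p` and uniform `L^p`-boundedness of the scheme
give a bound for the expected cost. -/
lemma cost_le {A : Params E} {Fk : ℕ → E × S → E} {V : ℕ → ℕ → ℕ → Ω → S} {θ₀ θstar : E} {C : ℕ → ℝ}
    {p : ℝ} (hp : 1 ≤ p) {B : ℝ} {a : ℕ → ℝ} (ha : ∀ n, 1 ≤ n → 0 ≤ a n)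
    (hstep : ∀ (n : ℕ) (θ : E), 1 ≤ n →
      ∑ k ∈ Finset.Icc 1 (maxLevel A n θ), (numIter A n k θ : ℝ) * C k ≤ a n * (1 + ‖θ‖) ^ p)
    (hL : ∀ n, MemLp (fun ω => scheme A Fk V θ₀ n ω - θstar) (ENNReal.ofReal p) P)
    (hB : ∀ n, lpNorm (fun ω => scheme A Fk V θ₀ n ω - θstar) (ENNReal.ofReal p) P ≤ B) (n : ℕ) :
    cost P A Fk V θ₀ C n
      ≤ ENNReal.ofReal ((B + (1 + ‖θstar‖)) ^ p * ∑ j ∈ Finset.Icc 1 n, a j) := by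
  have hp0 : 0 < p := by linarith
  have hp1 : 1 ≤ ENNReal.ofReal p := by
    rw [← ENNReal.ofReal_one]; exact ENNReal.ofReal_le_ofReal hp
  set T : ℕ → Ω → ℝ := fun j ω => 1 + ‖scheme A Fk V θ₀ j ω‖ with hT
  have hT0 (j ω) : 0 ≤ T j ω := by positivity
  have hθL (j : ℕ) : MemLp (scheme A Fk V θ₀ j) (ENNReal.ofReal p) P := by
    have := (hL j).add (memLp_const θstar)
    refine this.ae_eq (ae_of_all _ fun ω => ?_)
    simp
  have hTL (j : ℕ) : MemLp (T j) (ENNReal.ofReal p) P := (memLp_const (1 : ℝ)).add (hθL j).norm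
  have hTle (j : ℕ) : ∫ ω, T j ω ^ p ∂P ≤ (B + (1 + ‖θstar‖)) ^ p := by
    have h1 := integral_norm_rpow_eq_lpNorm hp0 (hTL j).1
    simp only [Real.norm_of_nonneg (hT0 j _)] at h1
    rw [h1]
    refine Real.rpow_le_rpow lpNorm_nonneg ?_ hp0.le
    have h2 := lpNorm_le_affine (X := T j) hp1 (hL j) zero_le_one
      (by positivity : 0 ≤ 1 + ‖θstar‖) fun ω => by
        rw [Real.norm_of_nonneg (hT0 j ω), one_mul]
        have := norm_add_le (scheme A Fk V θ₀ j ω - θstar) θstar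
        rw [sub_add_cancel] at this
        simp only [hT]
        linarith
    linarith [hB j]
  have hTi (j : ℕ) : Integrable (fun ω => T j ω ^ p) P := by
    have := integrable_norm_rpow_ofReal hp0 (hTL j)
    simpa only [Real.norm_of_nonneg (hT0 j _)] using this
  unfold cost
  calc _ ≤ ∫⁻ ω, ENNReal.ofReal (∑ j ∈ Finset.Icc 1 n, a j * T (j - 1) ω ^ p) ∂P := by
        refine lintegral_mono fun ω => ENNReal.ofReal_le_ofReal (Finset.sum_le_sum fun j hj => ?_)
        exact hstep j _ (Finset.mem_Icc.1 hj).1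
    _ = ENNReal.ofReal (∑ j ∈ Finset.Icc 1 n, a j * ∫ ω, T (j - 1) ω ^ p ∂P) := by
        rw [← ofReal_integral_eq_lintegral_ofReal
          (integrable_finsetSum _ fun j _ => (hTi (j - 1)).const_mul (a j))
          (ae_of_all _ fun ω => Finset.sum_nonneg fun j hj => mul_nonneg
            (ha j (Finset.mem_Icc.1 hj).1) (Real.rpow_nonneg (hT0 _ ω) p)),
          integral_finsetSum _ fun j _ => (hTi (j - 1)).const_mul (a j)]
        simp only [integral_const_mul]
    _ ≤ _ := by
        refine ENNReal.ofReal_le_ofReal ?_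
        rw [Finset.mul_sum]
        refine Finset.sum_le_sum fun j hj => ?_
        rw [mul_comm]
        exact mul_le_mul_of_nonneg_right (hTle (j - 1)) (ha j (Finset.mem_Icc.1 hj).1)

end Cost

end MLRM

/-! ### Error and cost of the multilevel scheme -/

theorem theorem3p1
    {E : Type*} [NormedAddCommGroup E] [InnerProductSpace ℝ E] [FiniteDimensional ℝ E]
    [MeasurableSpace E] [BorelSpace E]
    {Ω : Type*} [MeasurableSpace Ω] (P : Measure Ω) [IsProbabilityMeasure P]
    {S : Type*} [MeasurableSpace S]
    (p : ℝ) (hp : 2 ≤ p)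
    -- the random variable, the integrand, its approximations and their costs
    (U : Ω → S) (hU : Measurable U)
    (F : E × S → E) (hF : Measurable F)
    (hFint : ∀ θ, Integrable (fun ω => F (θ, U ω)) P)
    (Fk : ℕ → E × S → E) (hFk0 : ∀ x, Fk 0 x = 0)
    (hFk : ∀ k, 1 ≤ k → Measurable (Fk k))
    (hFkint : ∀ k, 1 ≤ k → ∀ θ, Integrable (fun ω => Fk k (θ, U ω)) P)
    (C : ℕ → ℝ) (hC : ∀ k, 1 ≤ k → 0 < C k)
    -- the unique zero of f
    (θstar : E) (hzero : ∀ θ, MLRM.meanFun P U F θ = 0 ↔ θ = θstar)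
    -- independent copies of U, indexed by triples of positive integers
    (V : ℕ → ℕ → ℕ → Ω → S)
    (hVmeas : ∀ n k l, 1 ≤ n → 1 ≤ k → 1 ≤ l → Measurable (V n k l))
    (hVlaw : ∀ n k l, 1 ≤ n → 1 ≤ k → 1 ≤ l → IdentDistrib (V n k l) U P P)
    (hVindep : iIndepFun (fun i : ℕ+ × ℕ+ × ℕ+ => V (i.1 : ℕ) (i.2.1 : ℕ) (i.2.2 : ℕ)) P)
    (L : ℝ) (hA1 : MLRM.AssumptionA1 (MLRM.meanFun P U F) θstar L)
    (A : MLRM.Params E)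
    (hC1 : MLRM.AssumptionC1 P U p F Fk C A) (hC2 : MLRM.AssumptionC2 p A)
    (θ₀ : E)
    -- the choice of the step-sizes, noise-levels and bias-levels
    (r γ₀ σ₀ ε₀ ρ : ℝ) (hr : -1 < r) (hγ₀ : (1 + r) / (2 * L) < γ₀)
    (hσ₀ : 0 < σ₀) (hε₀ : 0 < ε₀) (hρ : ρ = 1 / 2 * (1 + r))
    (hγ : ∀ n : ℕ, 1 ≤ n → A.γ n = γ₀ * (1 / (n : ℝ)))
    (hσpos : ∀ n : ℕ, 1 ≤ n → 0 < A.σ n)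
    (hσ : ∀ n : ℕ, 1 ≤ n → A.σ n ^ 2 = σ₀ ^ 2 * (1 / (n : ℝ) ^ r))
    (hε : ∀ n : ℕ, 1 ≤ n → A.ε n = ε₀ * (1 / (n : ℝ) ^ ρ)) :
    (∀ η : ℝ, 0 < η → η < ρ → ∃ κ : ℝ, 0 < κ ∧ ∀ n : ℕ, 1 ≤ n →
      (∫⁻ ω, ⨆ k : ℕ, ⨆ _ : n ≤ k, ENNReal.ofReal
          ((k : ℝ) ^ (η * p) * ‖MLRM.scheme A Fk V θ₀ k ω - θstar‖ ^ p) ∂P) ^ (1 / p)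
        ≤ ENNReal.ofReal (κ * (n : ℝ) ^ (-(ρ - η)))) ∧
    (∀ δ : ℝ, 0 < δ → ∀ᵐ ω ∂P, Tendsto
      (fun n : ℕ => (n : ℝ) ^ (ρ - δ) * ‖MLRM.scheme A Fk V θ₀ n ω - θstar‖) atTop (𝓝 0)) ∧
    (min A.β (1 / 2) < A.α → min A.β (1 / 2) / (A.α - min A.β (1 / 2)) < r →
      ∃ κ' : ℝ, 0 < κ' ∧ ∀ n : ℕ, 1 ≤ n →
        MLRM.cost P A Fk V θ₀ C n
          ≤ ENNReal.ofReal (κ' * MLRM.costRate A.α A.β ρ n)) := by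
  have hL := hA1.L_pos
  have hρ0 : 0 < ρ := by rw [hρ]; linarith
  obtain ⟨𝓕, lam, c, d, ζ, hlam, hrec⟩ := MLRM.exists_isContractiveRecursion_scheme p hp U hU F hFint
    Fk hFk0 hFk hFkint C θstar V hVmeas hVlaw hVindep L hA1 A hC1 θ₀ r γ₀ σ₀ ε₀ ρ hr hγ₀ hσ₀ hε₀ hρ
    hγ hσpos hσ hε
  refine ⟨fun η hη hηρ => hrec.exists_lintegral_iSup_le hp hρ0 hlam hη hηρ,
    fun δ hδ => hrec.ae_tendsto hp hρ0 hlam hδ, fun hαβ hcond => ?_⟩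
  obtain ⟨K, hK, hKn⟩ := hrec.exists_lpNorm_le hp hρ0 hlam
  obtain ⟨KC, hKC, hCK⟩ := hC1.cost
  obtain ⟨a, ha, hstep⟩ := MLRM.exists_sum_numIter_mul_le hC1.one_lt_M hC1.α_pos (by linarith) hε₀
    hσ₀ hρ0 hρ hε hσpos hσ hC1.Γ₁_pos hC1.Γ₂_pos hC2 hαβ hcond hKC hCK
  have hmin : 0 < min A.β (1 / 2) := lt_min hC1.β_pos (by norm_num)
  have hr0 : 0 < r := (div_pos hmin (sub_pos.2 hαβ)).trans hcond
  -- a bound for the `L^p` distance to the zero, uniform in time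
  set B := lpNorm (fun ω => MLRM.scheme A Fk V θ₀ 0 ω - θstar) (ENNReal.ofReal p) P + K with hBdef
  have hB0 : 0 < B := add_pos_of_nonneg_of_pos lpNorm_nonneg hK
  have hB (n : ℕ) :
      lpNorm (fun ω => MLRM.scheme A Fk V θ₀ n ω - θstar) (ENNReal.ofReal p) P ≤ B := by
    rcases Nat.eq_zero_or_pos n with rfl | hn
    · linarith
    · have h1 : (1 : ℝ) ≤ n := by exact_mod_cast hn
      have h2 := Real.rpow_le_one_of_one_le_of_nonpos h1 (by linarith : -ρ ≤ 0)
      have h3 : 0 ≤ lpNorm (fun ω => MLRM.scheme A Fk V θ₀ 0 ω - θstar) (ENNReal.ofReal p) P :=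
        lpNorm_nonneg
      nlinarith [hKn n hn]
  refine ⟨(B + (1 + ‖θstar‖)) ^ p * a, by positivity, fun n hn => ?_⟩
  have ha0 (j : ℕ) (hj : 1 ≤ j) : 0 ≤ a * ((j : ℝ) ^ r * MLRM.costFactor A.α A.β ρ j) := by
    have := MLRM.quarter_le_costFactor (β := A.β) hC1.α_pos hρ0 hj
    exact mul_nonneg ha.le (mul_nonneg (by positivity) (by linarith))
  refine (MLRM.cost_le (by linarith) ha0 hstep hrec.memLp hB n).trans (ENNReal.ofReal_le_ofReal ?_)
  rw [← Finset.mul_sum, ← mul_assoc]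
  exact mul_le_mul_of_nonneg_left
    (MLRM.sum_rpow_mul_costFactor_le hC1.α_pos hρ0 hρ hr0.le hn) (by positivity)
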